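/- **Setting.** For every $k\ge 1$ consider $k$ alternatives $1,\dots,k$. Observations of alternative $i$ are normal with mean $\mu_i$ and variance $\sigma_i^2$, and all observations are mutually independent. The means and variances of the alternatives $i\ge 2$ may depend on $k$; $\mu_1$ and $\sigma_1^2$ do not. There are constants $\gamma>0$ and $\bar\sigma>0$, independent of $k$, such that for all $k$ $$\mu_1-\mu_i\ge\gamma\quad(2\le i\le k),\qquad \sigma_i^2\le\bar\sigma^2\quad(1\le i\le k).$$ For $x\in\mathbb R$ and an integer $n\ge1$ let $C(x;n)=\mathrm E\big[\inf\{m\ge n:\bar Z(m)<x\}\big]$, where $\bar Z(m)$ is the average of the first $m$ terms of a sequence of independent standard normal variables. $\bar X_1(n)$ denotes the average of the first $n$ of a sequence of independent normal observations with mean $\mu_1$ and variance $\sigma_1^2$. **Procedure EFG$^+$** with integer parameters $G\ge2$, $n_{sd}\ge 1$, $n_0\ge G$, a real $n_g$, and total budget $(n_{sd}+n_0+n_g)k$. For $1\le r\le G$ let $n^r=\big\lfloor \frac{n_0(2^G-1)}{G\,2^{r-1}}\big\rfloor$. 1. *Seeding.* Take $n_{sd}$ observations of every alternative and sort the alternatives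 in descending order of their sample means. Cut the sorted list into consecutive groups $I^1,\dots,I^G$ (best alternatives first), where $|I^r|=\big\lfloor \frac{k2^{r-1}}{2^G-1}\big\rfloor$ for $r<G$ and $I^G$ contains all remaining alternatives. The seeding observations are then discarded. 2. *Exploration.* For each $r$, take $n^r$ new observations of every alternative in $I^r$. 3. *Greedy phase.* While the total number of observations taken in steps 2 and 3 is less than $(n_0+n_g)k$, take one more observation of the alternative whose current sample mean (of its observations from steps 2 and 3) is largest. 4. Select the alternative with the largest sample mean. Ties in the sorting and in the maxima are broken by arbitrary fixed rules. $\mathrm{PCS}$ is the probability that alternative $1$ is selected. **Theorem.** Let $n_g> C(\gamma/\bar\sigma;n^1)-n_0$, where $n^1=\big\lfloor \frac{n_0(2^G-1)}{G}\big\rfloor$. Then there is $\gamma_0\in(0,\gamma)$ with $$C\Big(\frac{\gamma-\gamma_0}{\bar\sigma};n^1\Big)=n_0+n_g,$$ and for every such $\gamma_0$ $$\liminf_{k\to\infty}\mathrm{PCS}\ \ge\ \Pr\Big\{\min_{n\ge n^G}\bar X_1(n)>\mu_1-\gamma_0\Big\},\qquad n^G=\Big\lfloor \frac{n_0(2^G-1)}{G\,2^{G-1}}\Big\rfloor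 .$$ -/

import Mathlib

open MeasureTheory ProbabilityTheory Filter
open scoped ENNReal NNReal

namespace RankSel

noncomputable section

/-- The running average `(x 0 + ⋯ + x (n - 1)) / n` of the first `n` observations of a stream. -/
def runAvg (x : ℕ → ℝ) (n : ℕ) : ℝ := (∑ j ∈ Finset.range n, x j) / n

/-- The boundary-crossing time `inf {n ≥ n₀ : runAvg z n < x}`, equal to `∞` if the running
average never falls below `x` from time `n₀` on. -/
def crossingTime (z : ℕ → ℝ) (x : ℝ) (n₀ : ℕ) : ℝ≥0∞ :=
  ⨅ (n : ℕ) (_ : n₀ ≤ n ∧ runAvg z n < x), (n : ℝ≥0∞)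

/-- The law of a sequence of independent normal observations with mean `m` and variance `v`. -/
def iidNormal (m : ℝ) (v : ℝ≥0) : Measure (ℕ → ℝ) :=
  Measure.infinitePi fun _ : ℕ => gaussianReal m v

/-- `C(x; n₀)`: the expected boundary-crossing time of the running average of independent
standard normal observations. -/
def meanCrossingTime (x : ℝ) (n₀ : ℕ) : ℝ≥0∞ :=
  ∫⁻ z, crossingTime z x n₀ ∂(iidNormal 0 1)

/-- A rule which, for every number `k ≥ 1` of alternatives (labelled `1, …, k`) and all values
`y 1, …, y k`, returns a maximizer; ties may be broken in any way. -/
def IsArgmaxRule (argmax : ℕ → (ℕ → ℝ) → ℕ) : Prop :=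
  ∀ k : ℕ, 1 ≤ k → ∀ y : ℕ → ℝ,
    argmax k y ∈ Finset.Icc 1 k ∧ ∀ i ∈ Finset.Icc 1 k, y i ≤ y (argmax k y)

/-- A rule which sorts `1, …, k` in descending order of `y`: `rank k y i` is the position
(in `1, …, k`) of alternative `i` in the sorted list; ties may be broken in any way. -/
def IsRankingRule (rank : ℕ → (ℕ → ℝ) → ℕ → ℕ) : Prop :=
  ∀ (k : ℕ) (y : ℕ → ℝ),
    Set.BijOn (rank k y) (Finset.Icc 1 k) (Finset.Icc 1 k) ∧
      ∀ i ∈ Finset.Icc 1 k, ∀ j ∈ Finset.Icc 1 k, y j < y i → rank k y i < rank k y j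

/-- The size `⌊k 2^(r-1) / (2^G - 1)⌋` of the group `r`, for `1 ≤ r < G`.  The last group `G`
consists of all the alternatives that remain. -/
def groupSize (k G r : ℕ) : ℕ := k * 2 ^ (r - 1) / (2 ^ G - 1)

/-- The group (in `1, …, G`) of the alternative in position `p` (in `1, …, k`) of the sorted
list: the first `groupSize k G 1` positions form group `1`, the next `groupSize k G 2` positions
form group `2`, and so on, and the positions left after group `G - 1` form group `G`. -/
def groupOf (k G p : ℕ) : ℕ :=
  1 + ((Finset.Icc 1 (G - 1)).filter
    fun r => ∑ q ∈ Finset.Icc 1 r, groupSize k G q < p).card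

/-- The number `n^r = ⌊n₀ (2^G - 1) / (G 2^(r-1))⌋` of observations which every alternative of
group `r` receives in the exploration phase (division of natural numbers rounds down). -/
def exploreSize (n₀ G r : ℕ) : ℕ := n₀ * (2 ^ G - 1) / (G * 2 ^ (r - 1))

/-- One pass of the greedy loop "while `n 1 + ⋯ + n k < b`, take one observation of the
alternative with the largest sample mean", on the vector `n` of current sample sizes.  Here
`x i` is the stream of observations of alternative `i`. -/
def greedyStep (argmax : ℕ → (ℕ → ℝ) → ℕ) (k : ℕ) (b : ℝ) (x : ℕ → ℕ → ℝ) (n : ℕ → ℕ) : ℕ → ℕ :=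
  if ((∑ i ∈ Finset.Icc 1 k, n i : ℕ) : ℝ) < b then
    Function.update n (argmax k fun i => runAvg (x i) (n i))
      (n (argmax k fun i => runAvg (x i) (n i)) + 1)
  else n

/-- The sample sizes when the greedy loop has ended.  Every pass that is not idle raises
`n 1 + ⋯ + n k` by one, so that the loop has ended after `⌈b⌉₊` passes. -/
def greedyLoop (argmax : ℕ → (ℕ → ℝ) → ℕ) (k : ℕ) (b : ℝ) (x : ℕ → ℕ → ℝ) (n : ℕ → ℕ) : ℕ → ℕ :=
  (greedyStep argmax k b x)^[⌈b⌉₊] n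

/-- The sample sizes at the end of the exploration phase; `obs (i, 0), obs (i, 1), …` are the
successive observations of alternative `i`, the first `nsd` of which are taken in the seeding
phase. -/
def exploreCounts (rank : ℕ → (ℕ → ℝ) → ℕ → ℕ) (k G nsd n₀ : ℕ) (obs : ℕ × ℕ → ℝ) : ℕ → ℕ :=
  fun i => exploreSize n₀ G
    (groupOf k G (rank k (fun i' => runAvg (fun j => obs (i', j)) nsd) i))

/-- The alternative selected by the enhanced explore-first greedy procedure with `k`
alternatives and total budget `(nsd + n₀ + ng) k`.  The seeding observations are discarded after
the seeding phase. -/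
def efgPlus (argmax : ℕ → (ℕ → ℝ) → ℕ) (rank : ℕ → (ℕ → ℝ) → ℕ → ℕ)
    (k G nsd n₀ : ℕ) (ng : ℝ) (obs : ℕ × ℕ → ℝ) : ℕ :=
  let x : ℕ → ℕ → ℝ := fun i j => obs (i, nsd + j)
  let n : ℕ → ℕ :=
    greedyLoop argmax k ((n₀ + ng) * k) x (exploreCounts rank k G nsd n₀ obs)
  argmax k fun i => runAvg (x i) (n i)

/-- The probability of correct selection: the probability that alternative `1` is selected when
all observations are independent and those of alternative `i` are normal with mean `m i` and
variance `v i`. -/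
def pcs (argmax : ℕ → (ℕ → ℝ) → ℕ) (rank : ℕ → (ℕ → ℝ) → ℕ → ℕ)
    (k G nsd n₀ : ℕ) (ng : ℝ) (m : ℕ → ℝ) (v : ℕ → ℝ≥0) : ℝ≥0∞ :=
  (Measure.infinitePi fun p : ℕ × ℕ => gaussianReal (m p.1) (v p.1))
    {obs | efgPlus argmax rank k G nsd n₀ ng obs = 1}

end

end RankSel

/-! Fix a level `b` slightly above `μ₁ - γ₀` and suppose that the average of alternative 1 stays
above `b` from time n^G on. A rival whose current average is below `b` is then never chosen, so
rival i receives at most T_i observations, where T_i is its first crossing of `b` from time n^1 on.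
Seeding and grouping enter only through the bounds n^G ≤ count ≤ n^1 after exploration, so the
argument is pathwise in the ranking. Let p ≥ n^1 be a time at which the average of alternative 1 is
minimal over its future. If the budget exceeds ∑ T_i + p, alternative 1 must receive an observation
beyond its p-th; when it does, all rivals are below its future minimum, and they stay there. This is
`argmax_greedyLoop_eq_one`.

For `b = μ₁ - γ₀ + δ` the mean of T_i is at most C((γ - γ₀ + δ)/σ; n^1), which is strictly less than
n₀ + n_g because C is strictly decreasing. The T_i are independent with bounded second moments, so
Chebyshev's inequality (`measure_sum_crossingTime_ge_le`) makes the budget sufficient with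
probability tending to 1. Letting k → ∞ for fixed δ and a fixed bound on p, and only then relaxing
both, gives the claim (`measure_forall_lt_runAvg_le_iSup`); this needs the almost sure existence of
p, `exists_min_runAvg_iidNormal`.

The existence of γ₀ is the intermediate value theorem: C is continuous on the positive axis, and a
Wald identity shows that it blows up at 0. -/

namespace RankSel

/-! ### Laws of running averages of normal streams. -/

section NormalStreams

instance isProbabilityMeasure_iidNormal (m : ℝ) (v : ℝ≥0) :
    IsProbabilityMeasure (iidNormal m v) := by
  unfold iidNormal; infer_instance

lemma iIndepFun_eval_iidNormal (m : ℝ) (v : ℝ≥0) :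
    iIndepFun (fun (i : ℕ) (x : ℕ → ℝ) => x i) (iidNormal m v) :=
  iIndepFun_infinitePi (P := fun _ : ℕ => gaussianReal m v) (X := fun _ (t : ℝ) => t)
    (fun _ => measurable_id)

lemma hasLaw_eval_iidNormal (m : ℝ) (v : ℝ≥0) (i : ℕ) :
    HasLaw (fun x : ℕ → ℝ => x i) (gaussianReal m v) (iidNormal m v) where
  aemeasurable := (measurable_pi_apply i).aemeasurable
  map_eq := Measure.infinitePi_map_eval (fun _ : ℕ => gaussianReal m v) i

@[fun_prop]
lemma measurable_runAvg (n : ℕ) : Measurable (fun x : ℕ → ℝ => runAvg x n) := by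
  unfold runAvg; fun_prop

lemma hasLaw_sum_iidNormal (m : ℝ) (v : ℝ≥0) (n : ℕ) :
    HasLaw (fun x : ℕ → ℝ => ∑ j ∈ Finset.range n, x j) (gaussianReal (n * m) (n * v))
      (iidNormal m v) where
  aemeasurable := by fun_prop
  map_eq := by
    induction n with
    | zero => simp [Measure.map_const]
    | succ n ih =>
      have hind : IndepFun (fun x : ℕ → ℝ => ∑ j ∈ Finset.range n, x j) (fun x => x n)
          (iidNormal m v) :=
        (iIndepFun_eval_iidNormal m v).indepFun_finsetSum_of_notMem
          (fun i => measurable_pi_apply i) (s := Finset.range n) (i := n) (by simp) |>.congr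
            (ae_of_all _ fun x => by simp) (ae_of_all _ fun x => rfl)
      have := gaussianReal_add_gaussianReal_of_indepFun hind ih (hasLaw_eval_iidNormal m v n).map_eq
      rw [show (fun x : ℕ → ℝ => ∑ j ∈ Finset.range (n + 1), x j)
        = (fun x : ℕ → ℝ => ∑ j ∈ Finset.range n, x j) + fun x => x n by
          ext x; simp [Finset.sum_range_succ]]
      rw [this]
      congr 1 <;> push_cast <;> ring

lemma hasLaw_runAvg_iidNormal (m : ℝ) (v : ℝ≥0) {n : ℕ} (hn : 1 ≤ n) :
    HasLaw (fun x : ℕ → ℝ => runAvg x n) (gaussianReal m (v / n)) (iidNormal m v) := by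
  have h := gaussianReal_div_const (hasLaw_sum_iidNormal m v n) (n : ℝ)
  have hn' : (n : ℝ) ≠ 0 := by positivity
  have e1 : (n : ℝ) * m / n = m := by field_simp
  have e2 : v / n = (n : ℝ≥0) * v / NNReal.mk ((n : ℝ) ^ 2) (sq_nonneg _) := by
    apply NNReal.eq
    rw [NNReal.coe_div, NNReal.coe_div, NNReal.coe_mul, NNReal.coe_mk, NNReal.coe_natCast]
    field_simp
  rw [e2]
  rw [e1] at h
  exact h

/-- The stream obtained from `z` by the affine change of variables which turns standard normal
observations into normal observations with mean `m` and variance `v`. -/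
noncomputable def affineStream (m : ℝ) (v : ℝ≥0) (z : ℕ → ℝ) : ℕ → ℝ := fun j => m + √v * z j

@[fun_prop]
lemma measurable_affineStream (m : ℝ) (v : ℝ≥0) : Measurable (affineStream m v) := by
  unfold affineStream; fun_prop

lemma map_affineStream (m : ℝ) (v : ℝ≥0) :
    (iidNormal 0 1).map (affineStream m v) = iidNormal m v := by
  unfold iidNormal affineStream
  have := Measure.infinitePi_map_pi (μ := fun _ : ℕ => gaussianReal 0 1)
    (f := fun _ (t : ℝ) => m + √v * t) (fun _ => by fun_prop)
  rw [this]
  congr 1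
  ext1 i
  have h1 : (gaussianReal 0 1).map (fun t => √v * t) = gaussianReal 0 v := by
    rw [gaussianReal_map_const_mul]
    congr 1
    · simp
    · ext; simp
  have h2 := gaussianReal_map_const_add (μ := 0) (v := v) m
  rw [zero_add, ← h1, Measure.map_map (by fun_prop) (by fun_prop)] at h2
  exact h2

lemma runAvg_affineStream (m : ℝ) (v : ℝ≥0) (z : ℕ → ℝ) {n : ℕ} (hn : 1 ≤ n) :
    runAvg (affineStream m v z) n = m + √v * runAvg z n := by
  have hn' : (n : ℝ) ≠ 0 := by positivity
  simp only [runAvg, affineStream, Finset.sum_add_distrib, ← Finset.mul_sum]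
  simp
  field_simp

lemma tendsto_runAvg_iidNormal (m : ℝ) (v : ℝ≥0) :
    ∀ᵐ x ∂iidNormal m v, Tendsto (runAvg x) atTop (nhds m) := by
  have hint : Integrable (fun x : ℕ → ℝ => x 0) (iidNormal m v) := by
    have h := hasLaw_eval_iidNormal m v 0
    have hid := memLp_id_gaussianReal (μ := m) (v := v) 1
    rw [← h.map_eq] at hid
    exact memLp_one_iff_integrable.1
      ((memLp_map_measure_iff (by fun_prop) h.aemeasurable).1 hid)
  have h := strong_law_ae_real (μ := iidNormal m v) (fun (i : ℕ) (x : ℕ → ℝ) => x i) hint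
    (fun i j hij => (iIndepFun_eval_iidNormal m v).indepFun hij)
    (fun i => (hasLaw_eval_iidNormal m v i).identDistrib (hasLaw_eval_iidNormal m v 0))
  have h0 : ∫ x, (x 0 : ℝ) ∂iidNormal m v = m := by
    rw [(hasLaw_eval_iidNormal m v 0).integral_eq]; simp
  rw [h0] at h
  exact h

end NormalStreams

/-! ### Pathwise analysis of the greedy loop. -/

section Greedy

variable {argmax : ℕ → (ℕ → ℝ) → ℕ} {k : ℕ} {B : ℝ} {x : ℕ → ℕ → ℝ}

lemma le_greedyStep (n : ℕ → ℕ) (i : ℕ) : n i ≤ greedyStep argmax k B x n i := by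
  unfold greedyStep
  split_ifs
  · by_cases hi : i = argmax k fun i => runAvg (x i) (n i)
    · rw [← hi]; simp
    · rw [Function.update_of_ne hi]
  · exact le_rfl

lemma greedyStep_cases (n : ℕ → ℕ) :
    greedyStep argmax k B x n = n ∨
      greedyStep argmax k B x n = Function.update n (argmax k fun i => runAvg (x i) (n i))
        (n (argmax k fun i => runAvg (x i) (n i)) + 1) := by
  unfold greedyStep
  split_ifs <;> simp

lemma sum_greedyStep (hargmax : IsArgmaxRule argmax) (hk : 1 ≤ k) (n : ℕ → ℕ)
    (hn : ((∑ i ∈ Finset.Icc 1 k, n i : ℕ) : ℝ) < B) :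
    ∑ i ∈ Finset.Icc 1 k, greedyStep argmax k B x n i = ∑ i ∈ Finset.Icc 1 k, n i + 1 := by
  have ha := (hargmax k hk fun i => runAvg (x i) (n i)).1
  simp only [greedyStep, if_pos hn]
  rw [Finset.sum_update_of_mem ha, ← Finset.add_sum_erase _ n ha, Finset.sdiff_singleton_eq_erase]
  ring

/-- Each pass adds one observation until the total reaches `B`. At `t = ⌈B⌉₊` this shows that the
budget is really spent. -/
lemma min_le_sum_iterate_greedyStep (hargmax : IsArgmaxRule argmax) (hk : 1 ≤ k) (n : ℕ → ℕ)
    (t : ℕ) :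
    min B t ≤ ((∑ i ∈ Finset.Icc 1 k, (greedyStep argmax k B x)^[t] n i : ℕ) : ℝ) := by
  induction t with
  | zero => exact (min_le_right _ _).trans (by rw [Nat.cast_zero]; exact Nat.cast_nonneg _)
  | succ t ih =>
    rw [Function.iterate_succ_apply']
    by_cases h : ((∑ i ∈ Finset.Icc 1 k, (greedyStep argmax k B x)^[t] n i : ℕ) : ℝ) < B
    · rw [sum_greedyStep hargmax hk _ h]
      push_cast at h ih ⊢
      rcases min_le_iff.1 ih with h' | h'
      · linarith
      · exact (min_le_right _ _).trans (by linarith)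
    · refine (min_le_left _ _).trans ((not_lt.1 h).trans ?_)
      exact_mod_cast Finset.sum_le_sum fun i _ => le_greedyStep _ i

lemma le_sum_greedyLoop (hargmax : IsArgmaxRule argmax) (hk : 1 ≤ k) (n : ℕ → ℕ) :
    B ≤ ((∑ i ∈ Finset.Icc 1 k, greedyLoop argmax k B x n i : ℕ) : ℝ) := by
  have := min_le_sum_iterate_greedyStep (B := B) (x := x) hargmax hk n ⌈B⌉₊
  rwa [min_eq_left (Nat.le_ceil B)] at this

/-- If `p` is a future minimum of the running average of alternative `1`, which stays above `b`,
every other alternative `i` has an average below `b` after `N i` observations, and the budget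
exceeds `∑ N i + p`, then the greedy loop ends with alternative `1` on top. -/
theorem argmax_greedyLoop_eq_one (hargmax : IsArgmaxRule argmax) (hk : 1 ≤ k)
    {c : ℕ → ℕ} {lo p : ℕ} {b : ℝ} {N : ℕ → ℕ}
    (hlo : lo ≤ c 1) (hpos : ∀ i, 1 ≤ c i) (hcp : c 1 ≤ p)
    (hb : ∀ n, lo ≤ n → b < runAvg (x 1) n)
    (hp : ∀ n, p ≤ n → runAvg (x 1) p ≤ runAvg (x 1) n)
    (htie : ∀ i ∈ Finset.Icc 2 k, ∀ n, 1 ≤ n → runAvg (x i) n ≠ runAvg (x 1) p)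
    (hN : ∀ i ∈ Finset.Icc 2 k, c i ≤ N i ∧ runAvg (x i) (N i) < b)
    (hB : ((∑ i ∈ Finset.Icc 2 k, N i : ℕ) : ℝ) + p < B) :
    argmax k (fun i => runAvg (x i) (greedyLoop argmax k B x c i)) = 1 := by
  have h1k : 1 ∈ Finset.Icc 1 k := Finset.mem_Icc.2 ⟨le_rfl, hk⟩
  have hsub : ∀ {i}, i ∈ Finset.Icc 2 k → i ∈ Finset.Icc 1 k := fun hi =>
    Finset.Icc_subset_Icc_left (by norm_num) hi
  -- Invariant: no rival exceeds its cap `N i`, and once alternative 1 has more than `p`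
  -- observations all rivals are strictly below its future minimum.
  have hinv : ∀ t, (∀ i, c i ≤ (greedyStep argmax k B x)^[t] c i) ∧
      (∀ i ∈ Finset.Icc 2 k, (greedyStep argmax k B x)^[t] c i ≤ N i) ∧
      (p < (greedyStep argmax k B x)^[t] c 1 → ∀ i ∈ Finset.Icc 2 k,
        runAvg (x i) ((greedyStep argmax k B x)^[t] c i) < runAvg (x 1) p) := by
    intro t
    induction t with
    | zero => exact ⟨fun i => le_rfl, fun i hi => (hN i hi).1, fun h => absurd h (not_lt.2 hcp)⟩
    | succ t ih =>
      obtain ⟨ih1, ih2, ih3⟩ := ih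
      rw [Function.iterate_succ_apply']
      set n := (greedyStep argmax k B x)^[t] c with hn
      refine ⟨fun i => (ih1 i).trans (le_greedyStep n i), ?_⟩
      rcases greedyStep_cases (argmax := argmax) (k := k) (B := B) (x := x) n with h | h
      · rw [h]; exact ⟨ih2, ih3⟩
      rw [h]
      obtain ⟨ha, hmax⟩ := hargmax k hk fun i => runAvg (x i) (n i)
      set a := argmax k fun i => runAvg (x i) (n i)
      have hmax1 := hmax 1 h1k
      constructor
      · intro i hi
        by_cases hia : i = a
        · rw [← hia, Function.update_self]
          rw [← hia] at hmax1
          -- A rival sitting at its cap has average below `b`, hence below alternative 1, and cannot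
          -- be the maximizer.
          refine Nat.succ_le_of_lt (lt_of_le_of_ne (ih2 i hi) fun heq => ?_)
          have h1 := hb (n 1) (hlo.trans (ih1 1))
          have h2 := (hN i hi).2
          rw [← heq] at h2
          exact absurd hmax1 (not_le.2 (h2.trans h1))
        · rw [Function.update_of_ne hia]; exact ih2 i hi
      · intro hlt i hi
        have hi2 : 2 ≤ i := (Finset.mem_Icc.1 hi).1
        by_cases ha1 : a = 1
        · rw [ha1, Function.update_self] at hlt
          rw [ha1, Function.update_of_ne (by omega)]
          -- The critical pass is the one from `p` to `p + 1`: alternative 1 is chosen with average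
          -- exactly `runAvg (x 1) p`, so the rivals are at most that, and strictly below since ties
          -- are excluded.
          rcases (Nat.lt_succ_iff.1 hlt).lt_or_eq with hlt' | heq
          · exact ih3 hlt' i hi
          · have := hmax i (hsub hi)
            rw [ha1] at this
            rw [heq] at htie ⊢
            exact lt_of_le_of_ne this (htie i hi _ ((hpos i).trans (ih1 i)))
        · rw [Function.update_of_ne (Ne.symm ha1)] at hlt
          have ha2 : a ∈ Finset.Icc 2 k := by
            rw [Finset.mem_Icc] at ha ⊢; omega
          exact absurd hmax1 (not_le.2 ((ih3 hlt a ha2).trans_le (hp _ hlt.le)))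
  obtain ⟨-, h2, h3⟩ := hinv ⌈B⌉₊
  change ∀ i ∈ Finset.Icc 2 k, greedyLoop argmax k B x c i ≤ N i at h2
  change p < greedyLoop argmax k B x c 1 → ∀ i ∈ Finset.Icc 2 k,
        runAvg (x i) (greedyLoop argmax k B x c i) < runAvg (x 1) p at h3
  have hsum := le_sum_greedyLoop (B := B) (x := x) hargmax hk c
  rw [← Finset.add_sum_Ioc_eq_sum_Icc hk] at hsum
  -- The rivals use at most `∑ N i` of the budget, so more than `p` observations are left for
  -- alternative 1.
  have hp1 : p < greedyLoop argmax k B x c 1 := by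
    have := Finset.sum_le_sum h2
    rw [show Finset.Icc 2 k = Finset.Ioc 1 k from rfl] at this hB
    have h' : ((∑ i ∈ Finset.Ioc 1 k, greedyLoop argmax k B x c i : ℕ) : ℝ)
      ≤ ((∑ i ∈ Finset.Ioc 1 k, N i : ℕ) : ℝ) := by exact_mod_cast this
    have : (p : ℝ) < (greedyLoop argmax k B x c 1 : ℝ) := by
      rw [Nat.cast_add] at hsum
      linarith
    exact_mod_cast this
  obtain ⟨ha, hmax⟩ := hargmax k hk fun i => runAvg (x i) (greedyLoop argmax k B x c i)
  by_contra hne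
  have ha2 := Finset.mem_Icc.1 ha
  have := h3 hp1 _ (Finset.mem_Icc.2 ⟨by omega, ha2.2⟩)
  exact absurd (hmax 1 h1k) (not_le.2 (this.trans_le (hp _ hp1.le)))

end Greedy

/-! ### Bounds on the exploration sizes. -/

section GroupSizes

lemma groupOf_mem_Icc {k G p : ℕ} (hG : 1 ≤ G) : groupOf k G p ∈ Finset.Icc 1 G := by
  have := Finset.card_filter_le (Finset.Icc 1 (G - 1))
    fun r => ∑ q ∈ Finset.Icc 1 r, groupSize k G q < p
  rw [Nat.card_Icc] at this
  rw [Finset.mem_Icc, groupOf]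
  omega

lemma exploreSize_antitone {n₀ G r s : ℕ} (hG : 1 ≤ G) (hrs : r ≤ s) :
    exploreSize n₀ G s ≤ exploreSize n₀ G r := by
  unfold exploreSize
  refine Nat.div_le_div_left (Nat.mul_le_mul_left _ (Nat.pow_le_pow_right (by norm_num) (by omega)))
    (by positivity)

lemma one_le_exploreSize_last {n₀ G : ℕ} (hG : 1 ≤ G) (hn₀ : G ≤ n₀) :
    1 ≤ exploreSize n₀ G G := by
  unfold exploreSize
  rw [Nat.le_div_iff_mul_le (by positivity), one_mul]
  refine Nat.mul_le_mul hn₀ ?_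
  obtain ⟨g, rfl⟩ : ∃ g, G = g + 1 := ⟨G - 1, by omega⟩
  have : 1 ≤ 2 ^ g := Nat.one_le_two_pow
  rw [pow_succ, Nat.add_sub_cancel]
  omega

end GroupSizes

/-! ### Moments, continuity and strict monotonicity of the crossing time. -/

section CrossingTime

variable {z : ℕ → ℝ} {x y : ℝ} {m : ℕ}

lemma crossingTime_le {N : ℕ} (hmN : m ≤ N) (hN : runAvg z N < x) :
    crossingTime z x m ≤ N :=
  iInf₂_le N ⟨hmN, hN⟩

lemma crossingTime_anti (h : x ≤ y) : crossingTime z y m ≤ crossingTime z x m :=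
  le_iInf₂ fun _ hn => crossingTime_le hn.1 (hn.2.trans_le h)

lemma crossingTime_eq {N : ℕ} (hmN : m ≤ N) (hN : runAvg z N < x)
    (hlt : ∀ n, m ≤ n → n < N → x ≤ runAvg z n) : crossingTime z x m = N := by
  refine le_antisymm (crossingTime_le hmN hN) (le_iInf₂ fun n hn => Nat.cast_le.2 ?_)
  by_contra h
  exact absurd hn.2 (not_lt.2 (hlt n hn.1 (not_le.1 h)))

lemma exists_first_crossing (h : ∃ n, m ≤ n ∧ runAvg z n < x) :
    ∃ N, m ≤ N ∧ runAvg z N < x ∧ (∀ n, m ≤ n → n < N → x ≤ runAvg z n) ∧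
      crossingTime z x m = N := by
  classical
  have hs := Nat.find_spec h
  have hm : ∀ n, m ≤ n → n < Nat.find h → x ≤ runAvg z n := fun n hn hlt => by
    have := Nat.find_min h hlt
    push Not at this
    exact this hn
  exact ⟨Nat.find h, hs.1, hs.2, hm, crossingTime_eq hs.1 hs.2 hm⟩

lemma exists_crossing_of_ne_top (h : crossingTime z x m ≠ ∞) :
    ∃ n, m ≤ n ∧ runAvg z n < x := by
  by_contra hne
  refine h (iInf₂_eq_top.2 fun n hn => absurd ⟨n, hn⟩ hne)

@[fun_prop]
lemma measurable_crossingTime (x : ℝ) (m : ℕ) :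
    Measurable fun z : ℕ → ℝ => crossingTime z x m := by
  classical
  have : (fun z : ℕ → ℝ => crossingTime z x m)
      = fun z => ⨅ n : ℕ, if m ≤ n ∧ runAvg z n < x then (n : ℝ≥0∞) else ∞ := by
    ext z
    simp only [crossingTime]
    refine iInf_congr fun n => ?_
    split_ifs with h <;> simp [h]
  rw [this]
  refine Measurable.iInf fun n => Measurable.ite ?_ measurable_const measurable_const
  exact (MeasurableSet.const _).inter (measurableSet_lt (measurable_runAvg n) measurable_const)

lemma measurableSet_le_runAvg (x : ℝ) (n : ℕ) : MeasurableSet {z : ℕ → ℝ | x ≤ runAvg z n} :=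
  measurableSet_le measurable_const (measurable_runAvg n)

lemma sum_range_two_mul_add_one (N : ℕ) : ∑ n ∈ Finset.range N, (2 * n + 1) = N ^ 2 := by
  induction N with
  | zero => rfl
  | succ N ih => rw [Finset.sum_range_succ, ih]; ring

/-- T² is the sum of the odd numbers 2n + 1 over n < T, and any n < T either precedes `m` or is a
time without crossing. Taking expectations reduces the second moment to tail probabilities at single
times. -/
lemma crossingTime_sq_le (z : ℕ → ℝ) (x : ℝ) (m : ℕ) :
    crossingTime z x m ^ 2 ≤ ∑' n : ℕ,
      ({z | n < m ∨ x ≤ runAvg z n} : Set (ℕ → ℝ)).indicator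
        (fun _ => ((2 * n + 1 : ℕ) : ℝ≥0∞)) z := by
  by_cases h : ∃ n, m ≤ n ∧ runAvg z n < x
  · obtain ⟨N, -, -, hlt, hT⟩ := exists_first_crossing h
    rw [hT]
    refine le_trans (le_of_eq ?_) (ENNReal.sum_le_tsum (Finset.range N))
    rw [← Nat.cast_pow, ← sum_range_two_mul_add_one, Nat.cast_sum]
    refine Finset.sum_congr rfl fun n hn => ?_
    rw [Set.indicator_of_mem]
    by_cases hmn : n < m
    · exact Or.inl hmn
    · exact Or.inr (hlt n (not_lt.1 hmn) (Finset.mem_range.1 hn))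
  · push Not at h
    refine le_top.trans (le_of_eq ?_)
    symm
    rw [← top_le_iff, ← ENNReal.tsum_const_eq_top_of_ne_zero (α := ℕ) one_ne_zero]
    refine ENNReal.tsum_le_tsum fun n => ?_
    rw [Set.indicator_of_mem]
    · norm_cast; omega
    · by_cases hmn : n < m
      · exact Or.inl hmn
      · exact Or.inr (h n (not_lt.1 hmn))

lemma crossingTime_le_sq (z : ℕ → ℝ) (x : ℝ) (m : ℕ) :
    crossingTime z x m ≤ crossingTime z x m ^ 2 := by
  by_cases h : ∃ n, m ≤ n ∧ runAvg z n < x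
  · obtain ⟨N, -, -, -, hT⟩ := exists_first_crossing h
    rw [hT]
    exact_mod_cast Nat.le_self_pow (by norm_num) N
  · have : crossingTime z x m = ∞ := by
      by_contra h'
      exact h (exists_crossing_of_ne_top h')
    simp [this]

lemma runAvg_ge_measure_le {n : ℕ} (hn : 1 ≤ n) (hx : 0 < x) :
    iidNormal 0 1 {z | x ≤ runAvg z n} ≤ ENNReal.ofReal (Real.exp (-(x ^ 2 / 2) * n)) := by
  have hlaw := hasLaw_sum_iidNormal 0 1 n
  have hn' : (0 : ℝ) < n := by positivity
  have hsub : HasSubgaussianMGF (fun z : ℕ → ℝ => ∑ j ∈ Finset.range n, z j) n (iidNormal 0 1) := by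
    constructor
    · intro t
      have := integrable_exp_mul_gaussianReal (μ := n * 0) (v := n * 1) t
      rw [← hlaw.map_eq] at this
      exact this.comp_aemeasurable hlaw.aemeasurable
    · intro t
      rw [mgf_gaussianReal hlaw.map_eq]
      simp
  have := hsub.measure_ge_le (ε := x * n) (by positivity)
  rw [← ofReal_measureReal]
  refine ENNReal.ofReal_le_ofReal ?_
  have hset : {z : ℕ → ℝ | x ≤ runAvg z n} = {z | x * n ≤ ∑ j ∈ Finset.range n, z j} := by
    ext z; simp only [Set.mem_ofPred_eq, runAvg]; rw [le_div_iff₀ hn']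
  rw [hset]
  refine this.trans (le_of_eq ?_)
  congr 1
  push_cast
  field_simp

/-- The Gaussian tail exp(-x²n/2) beats the weights 2n + 1; the finitely many terms with n ≤ m are
finite trivially. -/
lemma lintegral_crossingTime_sq_lt_top (hx : 0 < x) (m : ℕ) :
    ∫⁻ z, crossingTime z x m ^ 2 ∂iidNormal 0 1 < ∞ := by
  refine (lintegral_mono fun z => crossingTime_sq_le z x m).trans_lt ?_
  have hmeas : ∀ n : ℕ, MeasurableSet {z : ℕ → ℝ | n < m ∨ x ≤ runAvg z n} := fun n =>
    (MeasurableSet.const _).union (measurableSet_le_runAvg x n)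
  rw [lintegral_tsum fun n => (measurable_const.indicator (hmeas n)).aemeasurable]
  simp_rw [fun n => lintegral_indicator_const (μ := iidNormal 0 1) (hmeas n)
    ((2 * n + 1 : ℕ) : ℝ≥0∞)]
  rw [← Summable.sum_add_tsum_nat_add' (k := m + 1) ENNReal.summable]
  refine ENNReal.add_lt_top.2 ⟨ENNReal.sum_lt_top.2 fun n _ =>
    ENNReal.mul_lt_top (ENNReal.natCast_lt_top _) (measure_lt_top _ _), ?_⟩
  have hs : Summable fun n : ℕ => (2 * n + 1 : ℝ) * Real.exp (-(x ^ 2 / 2) * n) := by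
    have h1 := Real.summable_pow_mul_exp_neg_nat_mul 1 (r := x ^ 2 / 2) (by positivity)
    have h0 := Real.summable_pow_mul_exp_neg_nat_mul 0 (r := x ^ 2 / 2) (by positivity)
    refine ((h1.mul_left 2).add h0).congr fun n => ?_
    simp; ring
  have hs' := (summable_nat_add_iff (m + 1)).2 hs
  refine lt_of_le_of_lt ?_ hs'.tsum_ofReal_lt_top
  refine ENNReal.tsum_le_tsum fun n => ?_
  rw [ENNReal.ofReal_mul (by positivity)]
  refine mul_le_mul' ?_ ?_
  · refine le_of_eq ?_
    rw [← ENNReal.ofReal_natCast]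
    congr 1
    push_cast
    ring
  · refine le_trans (measure_mono ?_) (runAvg_ge_measure_le (n := n + (m + 1)) (by omega) hx)
    rintro z (h | h)
    · omega
    · exact h

lemma meanCrossingTime_lt_top (hx : 0 < x) (m : ℕ) : meanCrossingTime x m < ∞ :=
  (lintegral_mono fun z => crossingTime_le_sq z x m).trans_lt (lintegral_crossingTime_sq_lt_top hx m)

lemma crossingTime_lt_top_ae (hx : 0 < x) (m : ℕ) :
    ∀ᵐ z ∂iidNormal 0 1, crossingTime z x m < ∞ :=
  ae_lt_top (measurable_crossingTime x m) (meanCrossingTime_lt_top hx m).ne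

lemma runAvg_ne_ae {n : ℕ} (hn : 1 ≤ n) (x : ℝ) : ∀ᵐ z ∂iidNormal 0 1, runAvg z n ≠ x := by
  have h := hasLaw_runAvg_iidNormal 0 1 hn
  have : NullSingletonClass (gaussianReal 0 (1 / n)) := nullSingletonClass_gaussianReal (by positivity)
  have h2 : ∀ᵐ t ∂gaussianReal 0 (1 / n), t ≠ x := Measure.ae_ne _ x
  rw [← h.map_eq] at h2
  exact ae_of_ae_map h.aemeasurable h2

/-- Almost surely no average equals `x`, so all averages before the crossing exceed `x` strictly and
the crossing time is locally constant in the level. The crossing time of `x / 2` dominates. -/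
lemma continuousAt_meanCrossingTime (hx : 0 < x) (hm : 1 ≤ m) :
    ContinuousAt (fun x => meanCrossingTime x m) x := by
  unfold ContinuousAt meanCrossingTime
  refine tendsto_lintegral_filter_of_dominated_convergence (fun z => crossingTime z (x / 2) m)
    (Eventually.of_forall fun y => measurable_crossingTime y m) ?_
    (meanCrossingTime_lt_top (half_pos hx) m).ne ?_
  · filter_upwards [lt_mem_nhds (half_lt_self hx)] with y hy
    exact ae_of_all _ fun z => crossingTime_anti hy.le
  · have hne : ∀ᵐ z ∂iidNormal 0 1, ∀ n, 1 ≤ n → runAvg z n ≠ x := by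
      rw [ae_all_iff]; intro n
      by_cases hn : 1 ≤ n
      · filter_upwards [runAvg_ne_ae hn x] with z hz _ using hz
      · exact ae_of_all _ fun z h => absurd h hn
    filter_upwards [hne, crossingTime_lt_top_ae hx m] with z hz hT
    obtain ⟨N, hmN, hN, hlt, hTN⟩ := exists_first_crossing (exists_crossing_of_ne_top hT.ne)
    refine tendsto_nhds_of_eventually_eq ?_
    have h2 : ∀ᶠ y in nhds x, ∀ n ∈ Finset.Ico m N, y < runAvg z n := by
      rw [Filter.eventually_all_finset]
      intro n hn
      rw [Finset.mem_Ico] at hn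
      exact gt_mem_nhds (lt_of_le_of_ne (hlt n hn.1 hn.2) (hz n (hm.trans hn.1)).symm)
    filter_upwards [lt_mem_nhds hN, h2] with y hy hy2
    rw [hTN]
    exact crossingTime_eq hmN hy fun n h1 h2 => (hy2 n (Finset.mem_Ico.2 ⟨h1, h2⟩)).le

/-- If the average at time `m` falls in `(x, y)`, an event of positive probability, level `y` is
crossed at once and level `x` only later. -/
lemma meanCrossingTime_strictAnti (hx : 0 < x) (hxy : x < y) (hm : 1 ≤ m) :
    meanCrossingTime y m < meanCrossingTime x m := by
  unfold meanCrossingTime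
  have hlaw := hasLaw_runAvg_iidNormal 0 1 hm
  refine lintegral_strict_mono_of_ae_le_of_frequently_ae_lt
    (measurable_crossingTime x m).aemeasurable (meanCrossingTime_lt_top (hx.trans hxy) m).ne
    (ae_of_all _ fun z => crossingTime_anti hxy.le) ?_
  intro hae
  have hnull : iidNormal 0 1 {z | runAvg z m ∈ Set.Ioo x y} = 0 := by
    refine measure_mono_null ?_ hae
    intro z hz
    simp only [Set.mem_ofPred_eq, Set.mem_compl_iff, not_not] at hz ⊢
    rw [crossingTime_eq le_rfl hz.2 (fun n h1 h2 => absurd h1 (not_le.2 h2))]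
    refine ne_of_lt ?_
    by_cases h : crossingTime z x m = ∞
    · rw [h]; exact ENNReal.natCast_lt_top _
    obtain ⟨N, hmN, hN, hlt, hTN⟩ := exists_first_crossing (exists_crossing_of_ne_top h)
    rw [hTN, Nat.cast_lt]
    refine lt_of_le_of_ne hmN fun heq => ?_
    rw [← heq] at hN
    exact absurd hz.1 (not_lt.2 hN.le)
  have h0 : gaussianReal 0 (1 / m) (Set.Ioo x y) = 0 := by
    rw [← hlaw.map_eq, Measure.map_apply_of_aemeasurable hlaw.aemeasurable measurableSet_Ioo]
    exact hnull
  have hv : (1 / m : ℝ≥0) ≠ 0 := by positivity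
  have h1 := gaussianReal_absolutelyContinuous' 0 hv h0
  rw [Real.volume_Ioo, ENNReal.ofReal_eq_zero] at h1
  linarith

end CrossingTime

/-! ### Wald's identity and the blow-up of the mean crossing time at level 0. -/

section SmallLevels

/-- The event that the running average does not cross the level `x` from time `m` to time `j`. -/
def noCrossing (x : ℝ) (m j : ℕ) : Set (ℕ → ℝ) :=
  {z | ∀ n ∈ Finset.Icc m j, x ≤ runAvg z n}

lemma measurableSet_noCrossing {M : MeasurableSpace (ℕ → ℝ)} {j : ℕ}
    (hM : ∀ i < j, Measurable[M] fun z : ℕ → ℝ => z i) (x : ℝ) (m : ℕ) :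
    MeasurableSet[M] (noCrossing x m j) := by
  have : noCrossing x m j = ⋂ n ∈ Finset.Icc m j, {z | x ≤ runAvg z n} := by
    ext z; simp [noCrossing]
  rw [this]
  refine Finset.measurableSet_biInter _ fun n hn => ?_
  refine measurableSet_le measurable_const ?_
  refine Measurable.div_const (Finset.measurable_sum _ fun i hi => hM i ?_) _
  exact (Finset.mem_range.1 hi).trans_le (Finset.mem_Icc.1 hn).2

lemma measurableSet_noCrossing' (x : ℝ) (m j : ℕ) : MeasurableSet (noCrossing x m j) :=
  measurableSet_noCrossing (fun i _ => measurable_pi_apply i) x m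

/-- The event that T > j involves only the coordinates before `j`, hence is independent of `z j`. -/
lemma lintegral_mul_indicator_noCrossing {f : ℝ → ℝ≥0∞} (hf : Measurable f) (x : ℝ) (m j : ℕ) :
    ∫⁻ z, f (z j) * (noCrossing x m j).indicator 1 z ∂iidNormal 0 1
      = (∫⁻ t, f t ∂gaussianReal 0 1) * iidNormal 0 1 (noCrossing x m j) := by
  have hle : ∀ i : ℕ, MeasurableSpace.comap (fun z : ℕ → ℝ => z i) inferInstance
      ≤ MeasurableSpace.pi := fun i => (measurable_pi_apply i).comap_le
  have hind := indep_iSup_of_disjoint (μ := iidNormal 0 1) hle (iIndepFun_eval_iidNormal 0 1)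
    (S := {j}) (T := Set.Iio j) (by simp)
  rw [lintegral_mul_eq_lintegral_mul_lintegral_of_independent_measurableSpace
    (iSup₂_le fun i _ => hle i) (iSup₂_le fun i _ => hle i) hind]
  · rw [lintegral_indicator_one (measurableSet_noCrossing' x m j),
      (hasLaw_eval_iidNormal 0 1 j).lintegral_comp hf.aemeasurable]
  · refine hf.comp ((comap_measurable _).mono ?_ le_rfl)
    exact le_iSup₂_of_le (f := fun i (_ : i ∈ ({j} : Set ℕ)) =>
      MeasurableSpace.comap (fun z : ℕ → ℝ => z i) inferInstance) j rfl le_rfl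
  · refine Measurable.indicator (f := fun _ => 1) measurable_const
      (measurableSet_noCrossing (fun i hi => ?_) x m)
    refine (comap_measurable _).mono ?_ le_rfl
    exact le_iSup₂_of_le (f := fun i (_ : i ∈ Set.Iio j) =>
      MeasurableSpace.comap (fun z : ℕ → ℝ => z i) inferInstance) i hi le_rfl

lemma tsum_mul_indicator_noCrossing {z : ℕ → ℝ} {x : ℝ} {m N : ℕ} (hmN : m ≤ N)
    (hN : runAvg z N < x) (hlt : ∀ n, m ≤ n → n < N → x ≤ runAvg z n) (f : ℕ → ℝ≥0∞) :
    ∑' j, f j * (noCrossing x m j).indicator 1 z = ∑ j ∈ Finset.range N, f j := by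
  rw [tsum_eq_sum (s := Finset.range N)]
  · refine Finset.sum_congr rfl fun j hj => ?_
    rw [Set.indicator_of_mem, Pi.one_apply, mul_one]
    intro n hn
    rw [Finset.mem_Icc] at hn
    exact hlt n hn.1 (hn.2.trans_lt (Finset.mem_range.1 hj))
  · intro j hj
    rw [Set.indicator_of_notMem, mul_zero]
    intro h
    rw [Finset.mem_range, not_lt] at hj
    exact absurd hN (not_lt.2 (h N (Finset.mem_Icc.2 ⟨hmN, hj⟩)))

/-- This is S_T + (S_m)⁻ ≤ xT, with S_T split into positive and negative parts so that all terms
live in `ℝ≥0∞`. If S_m < 0 then T = m and the left side vanishes; otherwise S_T < xT suffices. -/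
lemma sum_positive_part_le {z : ℕ → ℝ} {x : ℝ} {m N : ℕ} (hm : 1 ≤ m) (hx : 0 < x) (hmN : m ≤ N)
    (hN : runAvg z N < x) (hlt : ∀ n, m ≤ n → n < N → x ≤ runAvg z n) :
    ∑ j ∈ Finset.range N, ENNReal.ofReal (z j) + ENNReal.ofReal (-∑ j ∈ Finset.range m, z j)
      ≤ ∑ j ∈ Finset.range N, ENNReal.ofReal (-z j) + ENNReal.ofReal x * N := by
  have hN0 : (0 : ℝ) < N := by exact_mod_cast hm.trans hmN
  have hm0 : (0 : ℝ) < m := by exact_mod_cast hm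
  have e : ∀ t : ℝ, ENNReal.ofReal t = ENNReal.ofReal (max t 0) := fun t => by simp
  have hsplit : ∑ j ∈ Finset.range N, max (z j) 0
      = ∑ j ∈ Finset.range N, max (-z j) 0 + ∑ j ∈ Finset.range N, z j := by
    rw [← Finset.sum_add_distrib]
    refine Finset.sum_congr rfl fun j _ => ?_
    rcases le_total (z j) 0 with h | h
    · rw [max_eq_right h, max_eq_left (by linarith)]; ring
    · rw [max_eq_left h, max_eq_right (by linarith)]; ring
  simp_rw [fun j => e (z j), fun j => e (-z j)]
  rw [e (-∑ j ∈ Finset.range m, z j), ← ENNReal.ofReal_natCast,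
    ← ENNReal.ofReal_sum_of_nonneg (fun _ _ => le_max_right _ _),
    ← ENNReal.ofReal_sum_of_nonneg (fun _ _ => le_max_right _ _),
    ← ENNReal.ofReal_mul hx.le,
    ← ENNReal.ofReal_add (Finset.sum_nonneg fun _ _ => le_max_right _ _) (le_max_right _ _),
    ← ENNReal.ofReal_add (Finset.sum_nonneg fun _ _ => le_max_right _ _) (by positivity)]
  refine ENNReal.ofReal_le_ofReal ?_
  rw [hsplit]
  have hSN : ∑ j ∈ Finset.range N, z j < x * N := by
    rwa [runAvg, div_lt_iff₀ hN0] at hN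
  rcases le_or_gt 0 (∑ j ∈ Finset.range m, z j) with h | h
  · rw [max_eq_right (by linarith)]; linarith
  · have hNm : N = m := by
      refine (hmN.eq_or_lt.resolve_right fun hlt' => ?_).symm
      have h1 := hlt m le_rfl hlt'
      rw [runAvg, le_div_iff₀ hm0] at h1
      nlinarith
    rw [hNm, max_eq_left (by linarith)]
    have : 0 ≤ x * m := by positivity
    linarith

/-- A form of Wald's identity: `x C(x; m)` is bounded below by the mean negative part of the sum
of `m` standard normal observations. -/
lemma lintegral_neg_sum_le_mul_meanCrossingTime {x : ℝ} {m : ℕ} (hm : 1 ≤ m) (hx : 0 < x) :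
    ∫⁻ z, ENNReal.ofReal (-∑ j ∈ Finset.range m, z j) ∂iidNormal 0 1
      ≤ ENNReal.ofReal x * meanCrossingTime x m := by
  have hC := meanCrossingTime_lt_top hx m
  have hwald : ∀ f : ℝ → ℝ≥0∞, Measurable f →
      ∫⁻ z, ∑' j, f (z j) * (noCrossing x m j).indicator 1 z ∂iidNormal 0 1
        = (∫⁻ t, f t ∂gaussianReal 0 1) * ∑' j, iidNormal 0 1 (noCrossing x m j) := by
    intro f hf
    have hmeas : ∀ j, AEMeasurable (fun z : ℕ → ℝ => f (z j) * (noCrossing x m j).indicator 1 z)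
        (iidNormal 0 1) := fun j => ((hf.comp (measurable_pi_apply j)).mul
      (measurable_one.indicator (measurableSet_noCrossing' x m j))).aemeasurable
    rw [lintegral_tsum hmeas]
    simp_rw [fun j => lintegral_mul_indicator_noCrossing hf x m j]
    exact ENNReal.tsum_mul_left
  have hfirst : ∀ᵐ z ∂iidNormal 0 1, ∃ N, m ≤ N ∧ runAvg z N < x ∧
      (∀ n, m ≤ n → n < N → x ≤ runAvg z n) ∧ crossingTime z x m = N := by
    filter_upwards [crossingTime_lt_top_ae hx m] with z hz
    exact exists_first_crossing (exists_crossing_of_ne_top hz.ne)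
  have hsum : ∑' j, iidNormal 0 1 (noCrossing x m j) ≤ meanCrossingTime x m := by
    have h1 := hwald (fun _ => 1) measurable_const
    simp only [lintegral_const, measure_univ, mul_one] at h1
    rw [one_mul] at h1
    rw [← h1]
    refine lintegral_mono_ae ?_
    filter_upwards [hfirst] with z ⟨N, hmN, hN, hlt, hT⟩
    rw [tsum_mul_indicator_noCrossing hmN hN hlt fun _ => 1, hT]
    simp
  have hsymm : ∫⁻ t, ENNReal.ofReal (-t) ∂gaussianReal 0 1
      = ∫⁻ t, ENNReal.ofReal t ∂gaussianReal 0 1 := by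
    have h := gaussianReal_map_neg (μ := 0) (v := 1)
    rw [neg_zero] at h
    conv_rhs => rw [← h]
    rw [lintegral_map (by fun_prop) (by fun_prop)]
  have hfin : ∫⁻ t, ENNReal.ofReal t ∂gaussianReal 0 1 < ∞ := by
    have hint : Integrable id (gaussianReal 0 1) :=
      memLp_one_iff_integrable.1 (memLp_id_gaussianReal 1)
    exact hint.lintegral_lt_top
  have hkey : ∫⁻ z, (∑' j, ENNReal.ofReal (z j) * (noCrossing x m j).indicator 1 z
        + ENNReal.ofReal (-∑ j ∈ Finset.range m, z j)) ∂iidNormal 0 1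
      ≤ ∫⁻ z, (∑' j, ENNReal.ofReal (-z j) * (noCrossing x m j).indicator 1 z
        + ENNReal.ofReal x * crossingTime z x m) ∂iidNormal 0 1 := by
    refine lintegral_mono_ae ?_
    filter_upwards [hfirst] with z ⟨N, hmN, hN, hlt, hT⟩
    rw [tsum_mul_indicator_noCrossing hmN hN hlt fun j => ENNReal.ofReal (z j),
      tsum_mul_indicator_noCrossing hmN hN hlt fun j => ENNReal.ofReal (-z j), hT]
    exact sum_positive_part_le hm hx hmN hN hlt
  rw [lintegral_add_right _ (by fun_prop), lintegral_add_right _ (by fun_prop),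
    lintegral_const_mul _ (by fun_prop), hwald _ ENNReal.measurable_ofReal,
    hwald (fun t => ENNReal.ofReal (-t)) (by fun_prop), hsymm] at hkey
  -- By symmetry of the normal law both sides contain the same term E[z⁺] · ∑ P(T > j), which is
  -- finite and cancels.
  exact (ENNReal.add_le_add_iff_left (ENNReal.mul_lt_top hfin (hsum.trans_lt hC)).ne).1 hkey

lemma lintegral_neg_sum_pos {m : ℕ} (hm : 1 ≤ m) :
    0 < ∫⁻ z, ENNReal.ofReal (-∑ j ∈ Finset.range m, z j) ∂iidNormal 0 1 := by
  rw [pos_iff_ne_zero]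
  intro h
  have hlaw := hasLaw_sum_iidNormal 0 1 m
  have hl := hlaw.lintegral_comp (f := fun t => ENNReal.ofReal (-t)) (by fun_prop)
  rw [hl, lintegral_eq_zero_iff (by fun_prop)] at h
  have hv : (m * 1 : ℝ≥0) ≠ 0 := by positivity
  have h0 : gaussianReal (m * 0) (m * 1) (Set.Iio 0) = 0 := by
    refine measure_mono_null ?_ h
    intro t ht
    simpa using ht
  have h1 := gaussianReal_absolutelyContinuous' _ hv h0
  simp at h1

lemma exists_lt_meanCrossingTime {m : ℕ} (hm : 1 ≤ m) {x₀ : ℝ} (hx₀ : 0 < x₀) {K : ℝ≥0∞}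
    (hK : K ≠ ∞) : ∃ x, 0 < x ∧ x < x₀ ∧ K < meanCrossingTime x m := by
  by_contra! h
  have hlim : Tendsto (fun x : ℝ => ENNReal.ofReal x * K) (nhdsWithin 0 (Set.Ioi 0)) (nhds 0) := by
    have h1 : Tendsto (fun x : ℝ => ENNReal.ofReal x) (nhds 0) (nhds 0) := by
      simpa using ENNReal.continuous_ofReal.tendsto 0
    have h2 := ENNReal.Tendsto.mul_const h1 (Or.inr hK)
    rw [zero_mul] at h2
    exact h2.mono_left nhdsWithin_le_nhds
  refine absurd (ge_of_tendsto hlim ?_) (not_le.2 (lintegral_neg_sum_pos hm))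
  filter_upwards [Ioo_mem_nhdsGT hx₀] with x hx
  refine (lintegral_neg_sum_le_mul_meanCrossingTime hm hx.1).trans ?_
  gcongr
  exact h x hx.1 hx.2

/-- Every value above `C(a / σ; m)` is attained by the mean crossing time at a lower level. -/
lemma exists_meanCrossingTime_eq {m : ℕ} (hm : 1 ≤ m) {γ σ : ℝ} (hγ : 0 < γ) (hσ : 0 < σ)
    {K : ℝ≥0∞} (hK : K ≠ ∞) (hlt : meanCrossingTime (γ / σ) m < K) :
    ∃ γ₀ : ℝ, 0 < γ₀ ∧ γ₀ < γ ∧ meanCrossingTime ((γ - γ₀) / σ) m = K := by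
  obtain ⟨x, hx0, hx, hKx⟩ := exists_lt_meanCrossingTime hm (div_pos hγ hσ) hK
  have hcont : ContinuousOn (fun x => meanCrossingTime x m) (Set.Icc x (γ / σ)) := fun y hy =>
    (continuousAt_meanCrossingTime (hx0.trans_le hy.1) hm).continuousWithinAt
  obtain ⟨y, hy, hyK⟩ := intermediate_value_Ioo' hx.le hcont ⟨hlt, hKx⟩
  have hy2 := (lt_div_iff₀ hσ).1 hy.2
  refine ⟨γ - y * σ, by linarith, ?_, ?_⟩
  · have : 0 < y * σ := mul_pos (hx0.trans hy.1) hσ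
    linarith
  · rw [← hyK]
    simp only [sub_sub_cancel]
    rw [mul_div_cancel_right₀ _ hσ.ne']

end SmallLevels

/-! ### Almost sure existence of a future minimum of the running average. -/

section FutureMinimum

/-- The event that the partial sums started at time `N` are unbounded below. -/
def sumsUnboundedBelow (N : ℕ) : Set (ℕ → ℝ) :=
  {z | ∀ K : ℕ, ∃ n, N ≤ n ∧ ∑ j ∈ Finset.Ico N n, z j < -(K : ℝ)}

lemma sumsUnboundedBelow_eq (N : ℕ) : sumsUnboundedBelow N = sumsUnboundedBelow 0 := by
  ext z
  have habs : ∀ n ≤ N, |∑ j ∈ Finset.range n, z j| ≤ ∑ j ∈ Finset.range N, |z j| := fun n hn =>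
    (Finset.abs_sum_le_sum_abs _ _).trans
      (Finset.sum_le_sum_of_subset_of_nonneg (Finset.range_mono hn) fun _ _ _ => abs_nonneg _)
  simp only [sumsUnboundedBelow, Set.mem_ofPred_eq, Nat.zero_le, true_and, Nat.Ico_zero_eq_range]
  constructor
  · intro h K
    obtain ⟨n, hn, hlt⟩ := h ⌈K + ∑ j ∈ Finset.range N, |z j|⌉₊
    refine ⟨n, ?_⟩
    have h1 := Nat.le_ceil (K + ∑ j ∈ Finset.range N, |z j|)
    have h2 := Finset.sum_range_add_sum_Ico z hn
    have h3 := (abs_le.1 (habs N le_rfl)).2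
    linarith
  · intro h K
    -- Lowering the target by `∑ |z j|` over `j < N` pays for the first `N` terms and also forces `n
    -- ≥ N`, since no earlier partial sum is that low.
    obtain ⟨n, hlt⟩ := h ⌈K + ∑ j ∈ Finset.range N, |z j|⌉₊
    have h1 := Nat.le_ceil (K + ∑ j ∈ Finset.range N, |z j|)
    have hK : (0 : ℝ) ≤ K := Nat.cast_nonneg K
    have hn : N ≤ n := by
      by_contra hn
      have := (abs_le.1 (habs n (not_le.1 hn).le)).1
      linarith
    refine ⟨n, hn, ?_⟩
    have h2 := Finset.sum_range_add_sum_Ico z hn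
    have h3 := (abs_le.1 (habs N le_rfl)).1
    linarith

lemma measurableSet_sumsUnboundedBelow {M : MeasurableSpace (ℕ → ℝ)} {N : ℕ}
    (hM : ∀ i, N ≤ i → Measurable[M] fun z : ℕ → ℝ => z i) :
    MeasurableSet[M] (sumsUnboundedBelow N) := by
  have : sumsUnboundedBelow N = ⋂ K : ℕ, ⋃ n : ℕ, ⋃ _ : N ≤ n,
      {z | ∑ j ∈ Finset.Ico N n, z j < -(K : ℝ)} := by
    ext z; simp [sumsUnboundedBelow]
  rw [this]
  refine MeasurableSet.iInter fun K => MeasurableSet.iUnion fun n => MeasurableSet.iUnion fun _ =>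
    measurableSet_lt (Finset.measurable_sum _ fun i hi => hM i (Finset.mem_Ico.1 hi).1)
      measurable_const

/-- The sum of (K + 1)² standard normals is below -(K + 1) with probability P(Z < -1), whatever `K`
is; this bound survives the decreasing intersection over `K`. -/
lemma measure_sumsUnboundedBelow_pos : 0 < iidNormal 0 1 (sumsUnboundedBelow 0) := by
  have hpos : 0 < gaussianReal 0 1 (Set.Iio (-1)) := by
    rw [pos_iff_ne_zero]
    intro h
    have := gaussianReal_absolutelyContinuous' 0 one_ne_zero h
    simp at this
  refine hpos.trans_le ?_
  have hset : sumsUnboundedBelow 0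
      = ⋂ K : ℕ, {z | ∃ n, ∑ j ∈ Finset.range n, z j < -((K : ℝ) + 1)} := by
    ext z
    simp only [sumsUnboundedBelow, Set.mem_ofPred_eq, Nat.zero_le, true_and,
      Nat.Ico_zero_eq_range, Set.mem_iInter]
    constructor
    · intro h K
      simpa using h (K + 1)
    · intro h K
      obtain ⟨n, hn⟩ := h K
      exact ⟨n, by linarith⟩
  have hmeas : ∀ K : ℕ, MeasurableSet
      {z : ℕ → ℝ | ∃ n, ∑ j ∈ Finset.range n, z j < -((K : ℝ) + 1)} := by
    intro K
    have : {z : ℕ → ℝ | ∃ n, ∑ j ∈ Finset.range n, z j < -((K : ℝ) + 1)}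
        = ⋃ n, {z | ∑ j ∈ Finset.range n, z j < -((K : ℝ) + 1)} := by
      ext z; simp
    rw [this]
    exact MeasurableSet.iUnion fun n => measurableSet_lt (by fun_prop) measurable_const
  rw [hset, Antitone.measure_iInter ?_ (fun K => (hmeas K).nullMeasurableSet)
    ⟨0, measure_ne_top _ _⟩]
  · refine le_iInf fun K => ?_
    have hlaw := hasLaw_sum_iidNormal 0 1 ((K + 1) ^ 2)
    have hsub : {z : ℕ → ℝ | ∑ j ∈ Finset.range ((K + 1) ^ 2), z j ∈ Set.Iio (-((K : ℝ) + 1))}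
        ⊆ {z | ∃ n, ∑ j ∈ Finset.range n, z j < -((K : ℝ) + 1)} := fun z hz => ⟨_, hz⟩
    refine le_trans (le_of_eq ?_) (measure_mono hsub)
    change _ = iidNormal 0 1
      ((fun z : ℕ → ℝ => ∑ j ∈ Finset.range ((K + 1) ^ 2), z j) ⁻¹' Set.Iio (-((K : ℝ) + 1)))
    rw [← Measure.map_apply_of_aemeasurable hlaw.aemeasurable measurableSet_Iio, hlaw.map_eq]
    have hmap := gaussianReal_map_const_mul (μ := 0) (v := 1) ((K : ℝ) + 1)
    have hv : (((K + 1) ^ 2 : ℕ) : ℝ≥0) * 1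
        = NNReal.mk (((K : ℝ) + 1) ^ 2) (sq_nonneg _) * 1 := by
      apply NNReal.eq; simp
    rw [hv, show (((K + 1) ^ 2 : ℕ) : ℝ) * 0 = ((K : ℝ) + 1) * 0 by simp, ← hmap,
      Measure.map_apply (by fun_prop) measurableSet_Iio]
    congr 1
    ext t
    have hK : (0 : ℝ) < K + 1 := by positivity
    simp only [Set.mem_Iio, Set.mem_preimage]
    constructor <;> intro h <;> nlinarith
  · intro K L hKL z hz
    obtain ⟨n, hn⟩ := hz
    have : (K : ℝ) ≤ L := by exact_mod_cast hKL
    exact ⟨n, by linarith⟩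

/-- The event does not depend on the starting time, so it is a tail event and Kolmogorov's zero-one
law applies. -/
lemma sumsUnboundedBelow_ae : ∀ᵐ z ∂iidNormal 0 1, z ∈ sumsUnboundedBelow 0 := by
  have h01 := measure_zero_or_one_of_measurableSet_limsup_atTop (μ := iidNormal 0 1)
    (fun i : ℕ => (measurable_pi_apply i).comap_le) (iIndepFun_eval_iidNormal 0 1)
    (t := sumsUnboundedBelow 0) (by
      rw [limsup_eq_iInf_iSup_of_nat, MeasurableSpace.measurableSet_iInf]
      intro N
      rw [← sumsUnboundedBelow_eq N]
      refine measurableSet_sumsUnboundedBelow fun i hi => ?_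
      refine (comap_measurable _).mono ?_ le_rfl
      exact le_iSup₂_of_le (f := fun i (_ : i ≥ N) =>
        MeasurableSpace.comap (fun z : ℕ → ℝ => z i) inferInstance) i hi le_rfl)
  have h1 := h01.resolve_left measure_sumsUnboundedBelow_pos.ne'
  exact (mem_ae_iff_prob_eq_one
    (measurableSet_sumsUnboundedBelow fun i _ => measurable_pi_apply i)).2 h1

lemma exists_neg_runAvg_of_sumsUnboundedBelow {z : ℕ → ℝ} (hz : z ∈ sumsUnboundedBelow 0)
    {m : ℕ} (hm : 1 ≤ m) : ∃ n, m ≤ n ∧ runAvg z n < 0 := by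
  rw [← sumsUnboundedBelow_eq m] at hz
  obtain ⟨n, hn, hlt⟩ := hz ⌈∑ j ∈ Finset.range m, z j⌉₊
  refine ⟨n, hn, div_neg_of_neg_of_pos ?_ (by exact_mod_cast hm.trans hn)⟩
  have h2 := Finset.sum_range_add_sum_Ico z hn
  have h1 := Nat.le_ceil (∑ j ∈ Finset.range m, z j)
  linarith

/-- Almost surely the running average of standard normal observations attains its minimum over
`n ≥ m`. -/
lemma exists_min_runAvg_stdNormal {m : ℕ} (hm : 1 ≤ m) :
    ∀ᵐ z ∂iidNormal 0 1, ∃ p, m ≤ p ∧ ∀ n, m ≤ n → runAvg z p ≤ runAvg z n := by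
  filter_upwards [sumsUnboundedBelow_ae, tendsto_runAvg_iidNormal 0 1] with z hz hlim
  -- The averages tend to 0, so all but finitely many exceed the negative value at `q`; a minimum
  -- over a finite window containing `q` is global.
  obtain ⟨q, hq, hq0⟩ := exists_neg_runAvg_of_sumsUnboundedBelow hz hm
  obtain ⟨M, hM⟩ := eventually_atTop.1 (hlim.eventually (lt_mem_nhds hq0))
  obtain ⟨p, hp, hmin⟩ := Finset.exists_min_image (Finset.Icc m (max M q)) (runAvg z)
    ⟨q, Finset.mem_Icc.2 ⟨hq, le_max_right _ _⟩⟩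
  refine ⟨p, (Finset.mem_Icc.1 hp).1, fun n hn => ?_⟩
  by_cases h : n ≤ max M q
  · exact hmin n (Finset.mem_Icc.2 ⟨hn, h⟩)
  · have h' := not_le.1 h
    exact (hmin q (Finset.mem_Icc.2 ⟨hq, le_max_right _ _⟩)).trans
      (hM n ((le_max_left _ _).trans h'.le)).le

lemma exists_min_runAvg_iidNormal (μ : ℝ) (v : ℝ≥0) {m : ℕ} (hm : 1 ≤ m) :
    ∀ᵐ x ∂iidNormal μ v, ∃ p, m ≤ p ∧ ∀ n, m ≤ n → runAvg x p ≤ runAvg x n := by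
  have hset : {x : ℕ → ℝ | ∃ p, m ≤ p ∧ ∀ n, m ≤ n → runAvg x p ≤ runAvg x n}
      = ⋃ p : ℕ, ⋃ _ : m ≤ p, ⋂ n : ℕ, ⋂ _ : m ≤ n, {x | runAvg x p ≤ runAvg x n} := by
    ext x; simp
  rw [← map_affineStream, ae_map_iff (by fun_prop) (by
    rw [hset]
    exact MeasurableSet.iUnion fun p => MeasurableSet.iUnion fun _ => MeasurableSet.iInter fun n =>
      MeasurableSet.iInter fun _ => measurableSet_le (by fun_prop) (by fun_prop))]
  filter_upwards [exists_min_runAvg_stdNormal hm] with z ⟨p, hp, hmin⟩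
  refine ⟨p, hp, fun n hn => ?_⟩
  rw [runAvg_affineStream _ _ _ (hm.trans hp), runAvg_affineStream _ _ _ (hm.trans hn)]
  have := mul_le_mul_of_nonneg_left (hmin n hn) (Real.sqrt_nonneg v)
  linarith

end FutureMinimum

/-! ### Comparison of crossing times with the standard normal case. -/

section AffineTransfer

lemma crossingTime_affineStream_le {μ b y σ : ℝ} {v : ℝ≥0} (hσ : 0 < σ) (hv : (v : ℝ) ≤ σ ^ 2)
    (hy : 0 < y) (hb : μ + σ * y ≤ b) {m : ℕ} (hm : 1 ≤ m) (z : ℕ → ℝ) :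
    crossingTime (affineStream μ v z) b m ≤ crossingTime z y m := by
  refine le_iInf₂ fun n hn => crossingTime_le hn.1 ?_
  rw [runAvg_affineStream _ _ _ (hm.trans hn.1)]
  have hs : √(v : ℝ) ≤ σ := Real.sqrt_le_iff.2 ⟨hσ.le, hv⟩
  have h0 := Real.sqrt_nonneg (v : ℝ)
  refine lt_of_lt_of_le ?_ hb
  rcases le_total (runAvg z n) 0 with h | h
  · nlinarith [mul_pos hσ hy]
  · nlinarith [hn.2]

lemma lintegral_crossingTime_pow_le {μ b y σ : ℝ} {v : ℝ≥0} (hσ : 0 < σ) (hv : (v : ℝ) ≤ σ ^ 2)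
    (hy : 0 < y) (hb : μ + σ * y ≤ b) {m : ℕ} (hm : 1 ≤ m) (q : ℕ) :
    ∫⁻ x, crossingTime x b m ^ q ∂iidNormal μ v ≤ ∫⁻ z, crossingTime z y m ^ q ∂iidNormal 0 1 := by
  rw [← map_affineStream μ v, lintegral_map (by fun_prop) (by fun_prop)]
  refine lintegral_mono fun z => ?_
  gcongr
  exact crossingTime_affineStream_le hσ hv hy hb hm z

end AffineTransfer

/-! ### Joint law of the streams, and absence of ties. -/

section Streams

/-- The joint law of the independent normal streams of all the alternatives. -/
noncomputable def streamLaw (m : ℕ → ℝ) (v : ℕ → ℝ≥0) : Measure (ℕ → ℕ → ℝ) :=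
  Measure.infinitePi fun i => iidNormal (m i) (v i)

variable (m : ℕ → ℝ) (v : ℕ → ℝ≥0)

instance isProbabilityMeasure_streamLaw : IsProbabilityMeasure (streamLaw m v) := by
  unfold streamLaw; infer_instance

lemma hasLaw_shift_streams (s : ℕ) :
    HasLaw (fun (obs : ℕ × ℕ → ℝ) i j => obs (i, s + j)) (streamLaw m v)
      (Measure.infinitePi fun p : ℕ × ℕ => gaussianReal (m p.1) (v p.1)) where
  aemeasurable := (measurable_pi_lambda _ fun i => measurable_pi_lambda _ fun j =>
    measurable_pi_apply (i, s + j)).aemeasurable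
  map_eq := by
    have hinj : Function.Injective fun p : ℕ × ℕ => (p.1, s + p.2) := by
      rintro ⟨a, b⟩ ⟨c, d⟩ h
      simp only [Prod.mk.injEq, Nat.add_left_cancel_iff] at h
      simp [h.1, h.2]
    have h1 := Measure.map_infinitePi_infinitePi_of_inj
      (P := fun p : ℕ × ℕ => gaussianReal (m p.1) (v p.1)) hinj
    have h2 := Measure.infinitePi_map_curry (fun i (_ : ℕ) => gaussianReal (m i) (v i))
    unfold streamLaw iidNormal
    rw [← h2]
    conv_rhs => rw [show (Measure.infinitePi fun p : ℕ × ℕ => gaussianReal (m p.1) (v p.1))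
      = _ from h1.symm]
    rw [Measure.map_map (MeasurableEquiv.measurable _) (by fun_prop)]
    rfl

lemma hasLaw_eval_streamLaw (i : ℕ) :
    HasLaw (fun X : ℕ → ℕ → ℝ => X i) (iidNormal (m i) (v i)) (streamLaw m v) where
  aemeasurable := (measurable_pi_apply i).aemeasurable
  map_eq := Measure.infinitePi_map_eval (fun i => iidNormal (m i) (v i)) i

lemma iIndepFun_eval_streamLaw :
    iIndepFun (fun (i : ℕ) (X : ℕ → ℕ → ℝ) => X i) (streamLaw m v) :=
  iIndepFun_infinitePi (P := fun i => iidNormal (m i) (v i)) (X := fun _ (t : ℕ → ℝ) => t)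
    (fun _ => measurable_id)

variable {m v}

lemma gaussianReal_ae_ne_zero {a : ℝ} (ha : a ≠ 0) (w : ℝ≥0) : ∀ᵐ t ∂gaussianReal a w, t ≠ 0 := by
  by_cases hw : w = 0
  · rw [hw, gaussianReal_zero_var, ae_dirac_eq]
    exact ha
  · have := nullSingletonClass_gaussianReal (μ := a) hw
    exact Measure.ae_ne _ 0

/-- The difference is normal with nonzero mean, so it is almost surely nonzero even when both
variances vanish. -/
lemma runAvg_ne_runAvg_ae {i l : ℕ} (hil : i ≠ l) (hm : m i ≠ m l) {n p : ℕ} (hn : 1 ≤ n)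
    (hp : 1 ≤ p) : ∀ᵐ X ∂streamLaw m v, runAvg (X i) n ≠ runAvg (X l) p := by
  have hi := (hasLaw_runAvg_iidNormal (m i) (v i) hn).comp (hasLaw_eval_streamLaw m v i)
  have hl := gaussianReal_neg
    ((hasLaw_runAvg_iidNormal (m l) (v l) hp).comp (hasLaw_eval_streamLaw m v l))
  have hind := ((iIndepFun_eval_streamLaw m v).indepFun hil).comp (measurable_runAvg n)
    (measurable_runAvg p).neg
  have hsum := gaussianReal_add_gaussianReal_of_indepFun hind hi.map_eq hl.map_eq
  have hne := gaussianReal_ae_ne_zero (a := m i + -m l) (by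
    rw [← sub_eq_add_neg]; exact sub_ne_zero.2 hm) (v i / n + v l / p)
  rw [← hsum] at hne
  filter_upwards [ae_of_ae_map (hi.aemeasurable.add hl.aemeasurable) hne] with X hX heq
  refine hX ?_
  simp [heq]

end Streams

/-! ### Concentration of the total crossing time of the rivals. -/

section TotalCrossingTime

variable {m : ℕ → ℝ} {v : ℕ → ℝ≥0} {b y σ : ℝ} {h : ℕ} {i : ℕ}

lemma measurable_crossingTime_eval (b : ℝ) (h i : ℕ) :
    Measurable fun X : ℕ → ℕ → ℝ => crossingTime (X i) b h :=
  (measurable_crossingTime b h).comp (measurable_pi_apply i)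

lemma measurable_toReal_crossingTime_eval (b : ℝ) (h i : ℕ) :
    Measurable fun X : ℕ → ℕ → ℝ => (crossingTime (X i) b h).toReal :=
  (measurable_crossingTime_eval b h i).ennreal_toReal

lemma lintegral_crossingTime_pow_streamLaw_le (hσ : 0 < σ) (hv : (v i : ℝ) ≤ σ ^ 2)
    (hy : 0 < y) (hb : m i + σ * y ≤ b) (hh : 1 ≤ h) (q : ℕ) :
    ∫⁻ X, crossingTime (X i) b h ^ q ∂streamLaw m v
      ≤ ∫⁻ z, crossingTime z y h ^ q ∂iidNormal 0 1 := by
  refine le_trans (le_of_eq ?_) (lintegral_crossingTime_pow_le hσ hv hy hb hh q)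
  exact (hasLaw_eval_streamLaw m v i).lintegral_comp
    (f := fun x => crossingTime x b h ^ q) (by fun_prop)

lemma crossingTime_streamLaw_lt_top (hσ : 0 < σ) (hv : (v i : ℝ) ≤ σ ^ 2)
    (hy : 0 < y) (hb : m i + σ * y ≤ b) (hh : 1 ≤ h) :
    ∀ᵐ X ∂streamLaw m v, crossingTime (X i) b h < ∞ := by
  have := lintegral_crossingTime_pow_streamLaw_le (m := m) hσ hv hy hb hh 1
  simp only [pow_one] at this
  exact ae_lt_top (by fun_prop) (this.trans_lt (meanCrossingTime_lt_top hy h)).ne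

lemma lintegral_enorm_crossingTime_sq_le (hσ : 0 < σ) (hv : (v i : ℝ) ≤ σ ^ 2)
    (hy : 0 < y) (hb : m i + σ * y ≤ b) (hh : 1 ≤ h) :
    ∫⁻ X, ‖(crossingTime (X i) b h).toReal‖ₑ ^ 2 ∂streamLaw m v
      ≤ ∫⁻ z, crossingTime z y h ^ 2 ∂iidNormal 0 1 := by
  refine le_trans (lintegral_mono fun X => ?_)
    (lintegral_crossingTime_pow_streamLaw_le (m := m) hσ hv hy hb hh 2)
  gcongr
  rw [Real.enorm_of_nonneg ENNReal.toReal_nonneg]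
  exact ENNReal.ofReal_toReal_le

lemma memLp_crossingTime_streamLaw (hσ : 0 < σ) (hv : (v i : ℝ) ≤ σ ^ 2)
    (hy : 0 < y) (hb : m i + σ * y ≤ b) (hh : 1 ≤ h) :
    MemLp (fun X : ℕ → ℕ → ℝ => (crossingTime (X i) b h).toReal) 2 (streamLaw m v) := by
  refine ⟨(measurable_toReal_crossingTime_eval b h i).aestronglyMeasurable, ?_⟩
  rw [eLpNorm_lt_top_iff_lintegral_rpow_enorm_lt_top two_ne_zero ENNReal.ofNat_ne_top]
  have := lintegral_enorm_crossingTime_sq_le (m := m) hσ hv hy hb hh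
  simpa using this.trans_lt (lintegral_crossingTime_sq_lt_top hy h)

lemma integral_crossingTime_streamLaw_le (hσ : 0 < σ) (hv : (v i : ℝ) ≤ σ ^ 2)
    (hy : 0 < y) (hb : m i + σ * y ≤ b) (hh : 1 ≤ h) :
    ∫ X, (crossingTime (X i) b h).toReal ∂streamLaw m v ≤ (meanCrossingTime y h).toReal := by
  rw [integral_toReal (measurable_crossingTime_eval b h i).aemeasurable
    (crossingTime_streamLaw_lt_top hσ hv hy hb hh)]
  refine ENNReal.toReal_mono (meanCrossingTime_lt_top hy h).ne ?_
  simpa [meanCrossingTime] using lintegral_crossingTime_pow_streamLaw_le (m := m) hσ hv hy hb hh 1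

lemma variance_crossingTime_streamLaw_le (hσ : 0 < σ) (hv : (v i : ℝ) ≤ σ ^ 2)
    (hy : 0 < y) (hb : m i + σ * y ≤ b) (hh : 1 ≤ h) :
    variance (fun X : ℕ → ℕ → ℝ => (crossingTime (X i) b h).toReal) (streamLaw m v)
      ≤ (∫⁻ z, crossingTime z y h ^ 2 ∂iidNormal 0 1).toReal := by
  refine (variance_le_expectation_sq
    (measurable_toReal_crossingTime_eval b h i).aestronglyMeasurable).trans ?_
  simp only [Pi.pow_apply]
  rw [integral_eq_lintegral_of_nonneg_ae (ae_of_all _ fun X => sq_nonneg _)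
    ((measurable_toReal_crossingTime_eval b h i).pow_const 2).aestronglyMeasurable]
  refine ENNReal.toReal_mono (lintegral_crossingTime_sq_lt_top hy h).ne ?_
  refine le_trans (le_of_eq (lintegral_congr fun X => ?_))
    (lintegral_enorm_crossingTime_sq_le (m := m) hσ hv hy hb hh)
  rw [Real.enorm_of_nonneg ENNReal.toReal_nonneg, ← ENNReal.ofReal_pow ENNReal.toReal_nonneg]

/-- Chebyshev's inequality for the total crossing time of the alternatives `2, …, k`. -/
lemma measure_sum_crossingTime_ge_le {k : ℕ} (hk : 1 ≤ k) (hσ : 0 < σ)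
    (hv : ∀ i ∈ Finset.Icc 2 k, (v i : ℝ) ≤ σ ^ 2) (hy : 0 < y)
    (hb : ∀ i ∈ Finset.Icc 2 k, m i + σ * y ≤ b) (hh : 1 ≤ h) {ε : ℝ} (hε : 0 < ε) :
    streamLaw m v {X | k * ((meanCrossingTime y h).toReal + ε)
        ≤ ∑ i ∈ Finset.Icc 2 k, (crossingTime (X i) b h).toReal}
      ≤ ENNReal.ofReal ((∫⁻ z, crossingTime z y h ^ 2 ∂iidNormal 0 1).toReal / ε ^ 2 * (k : ℝ)⁻¹) := by
  set Y : ℕ → (ℕ → ℕ → ℝ) → ℝ := fun i X => (crossingTime (X i) b h).toReal with hY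
  set C := (meanCrossingTime y h).toReal with hC
  set D := (∫⁻ z, crossingTime z y h ^ 2 ∂iidNormal 0 1).toReal with hD
  have hk0 : (0 : ℝ) < k := by exact_mod_cast hk
  have hC0 : 0 ≤ C := ENNReal.toReal_nonneg
  have hD0 : 0 ≤ D := ENNReal.toReal_nonneg
  have hcard : ((Finset.Icc 2 k).card : ℝ) ≤ k := by
    rw [Nat.card_Icc]
    exact_mod_cast (by omega : k + 1 - 2 ≤ k)
  have hLp : ∀ i ∈ Finset.Icc 2 k, MemLp (Y i) 2 (streamLaw m v) := fun i hi =>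
    memLp_crossingTime_streamLaw hσ (hv i hi) hy (hb i hi) hh
  have hmean : ∫ X, (∑ i ∈ Finset.Icc 2 k, Y i) X ∂streamLaw m v ≤ k * C := by
    simp only [Finset.sum_apply]
    rw [integral_finsetSum _ fun i hi => (hLp i hi).integrable one_le_two]
    refine (Finset.sum_le_card_nsmul _ _ C fun i hi =>
      integral_crossingTime_streamLaw_le hσ (hv i hi) hy (hb i hi) hh).trans ?_
    rw [nsmul_eq_mul]
    exact mul_le_mul_of_nonneg_right hcard hC0
  have hvar : variance (∑ i ∈ Finset.Icc 2 k, Y i) (streamLaw m v) ≤ k * D := by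
    rw [IndepFun.variance_sum hLp fun i _ j _ hij =>
      ((iIndepFun_eval_streamLaw m v).indepFun hij).comp
        (φ := fun x => (crossingTime x b h).toReal) (ψ := fun x => (crossingTime x b h).toReal)
        (by fun_prop) (by fun_prop)]
    refine (Finset.sum_le_card_nsmul _ _ D fun i hi =>
      variance_crossingTime_streamLaw_le hσ (hv i hi) hy (hb i hi) hh).trans ?_
    rw [nsmul_eq_mul]
    exact mul_le_mul_of_nonneg_right hcard hD0
  have hcheb := meas_ge_le_variance_div_sq (memLp_finsetSum' _ hLp) (mul_pos hk0 hε)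
  refine (measure_mono fun X hX => ?_).trans (hcheb.trans (ENNReal.ofReal_le_ofReal ?_))
  · simp only [Set.mem_ofPred_eq] at hX ⊢
    refine le_trans ?_ (le_abs_self _)
    rw [Finset.sum_apply]
    have : k * (C + ε) ≤ ∑ i ∈ Finset.Icc 2 k, Y i X := hX
    linarith
  · rw [div_le_iff₀ (by positivity)]
    refine hvar.trans (le_of_eq ?_)
    field_simp

end TotalCrossingTime

/-! ### From the pathwise argument to the probability of correct selection. -/

section Selection

/-- The event that the running average stays above `b` from time `lo` on and has a future minimum
at some time between `hi` and `j`. -/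
def staysAbove (b : ℝ) (lo hi j : ℕ) : Set (ℕ → ℝ) :=
  {x | (∀ n, lo ≤ n → b < runAvg x n) ∧
    ∃ p, p ≤ j ∧ hi ≤ p ∧ ∀ n, p ≤ n → runAvg x p ≤ runAvg x n}

lemma measurableSet_staysAbove (b : ℝ) (lo hi j : ℕ) : MeasurableSet (staysAbove b lo hi j) := by
  have : staysAbove b lo hi j = (⋂ n : ℕ, ⋂ _ : lo ≤ n, {x | b < runAvg x n}) ∩
      ⋃ p : ℕ, ⋃ _ : p ≤ j ∧ hi ≤ p, ⋂ n : ℕ, ⋂ _ : p ≤ n, {x | runAvg x p ≤ runAvg x n} := by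
    ext x; simp [staysAbove, and_assoc]
  rw [this]
  refine (MeasurableSet.iInter fun n => MeasurableSet.iInter fun _ =>
    measurableSet_lt (by fun_prop) (by fun_prop)).inter ?_
  exact MeasurableSet.iUnion fun p => MeasurableSet.iUnion fun _ => MeasurableSet.iInter fun n =>
    MeasurableSet.iInter fun _ => measurableSet_le (by fun_prop) (by fun_prop)

/-- The streams of observations taken after the seeding phase. -/
def postSeeding (nsd : ℕ) (obs : ℕ × ℕ → ℝ) : ℕ → ℕ → ℝ := fun i j => obs (i, nsd + j)

variable {argmax : ℕ → (ℕ → ℝ) → ℕ} {rank : ℕ → (ℕ → ℝ) → ℕ → ℕ} {k G nsd n₀ : ℕ} {ng b B : ℝ}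

lemma efgPlus_eq_one (hargmax : IsArgmaxRule argmax) (hk : 1 ≤ k) (hG : 1 ≤ G) (hn₀ : G ≤ n₀)
    {obs : ℕ × ℕ → ℝ} {j : ℕ}
    (h1 : postSeeding nsd obs 1 ∈ staysAbove b (exploreSize n₀ G G) (exploreSize n₀ G 1) j)
    (htie : ∀ i ∈ Finset.Icc 2 k, ∀ n, 1 ≤ n → ∀ p, 1 ≤ p →
      runAvg (postSeeding nsd obs i) n ≠ runAvg (postSeeding nsd obs 1) p)
    (hfin : ∀ i ∈ Finset.Icc 2 k,
      crossingTime (postSeeding nsd obs i) b (exploreSize n₀ G 1) < ∞)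
    (hsum : ∑ i ∈ Finset.Icc 2 k,
        (crossingTime (postSeeding nsd obs i) b (exploreSize n₀ G 1)).toReal < B)
    (hB : B + j ≤ (n₀ + ng) * k) : efgPlus argmax rank k G nsd n₀ ng obs = 1 := by
  obtain ⟨hstay, p, hpj, hp, hmin⟩ := h1
  have hlast := one_le_exploreSize_last hG hn₀
  have hlh : exploreSize n₀ G G ≤ exploreSize n₀ G 1 := exploreSize_antitone hG hG
  have hcross : ∀ i, ∃ N : ℕ, i ∈ Finset.Icc 2 k → exploreSize n₀ G 1 ≤ N ∧
      runAvg (postSeeding nsd obs i) N < b ∧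
      crossingTime (postSeeding nsd obs i) b (exploreSize n₀ G 1) = N := by
    intro i
    by_cases hi : i ∈ Finset.Icc 2 k
    · obtain ⟨N, hN, hlt, -, hT⟩ := exists_first_crossing (exists_crossing_of_ne_top (hfin i hi).ne)
      exact ⟨N, fun _ => ⟨hN, hlt, hT⟩⟩
    · exact ⟨0, fun h => absurd h hi⟩
  choose N hN using hcross
  have hcount : ∀ i, exploreSize n₀ G G ≤ exploreCounts rank k G nsd n₀ obs i ∧
      exploreCounts rank k G nsd n₀ obs i ≤ exploreSize n₀ G 1 := by
    intro i
    have hg := Finset.mem_Icc.1 (groupOf_mem_Icc (k := k)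
      (p := rank k (fun i' => runAvg (fun j => obs (i', j)) nsd) i) hG)
    exact ⟨exploreSize_antitone hG hg.2, exploreSize_antitone hG hg.1⟩
  refine argmax_greedyLoop_eq_one (x := postSeeding nsd obs) hargmax hk (b := b) (N := N)
    (hcount 1).1 (fun i => hlast.trans (hcount i).1) ((hcount 1).2.trans hp) hstay hmin
    (fun i hi n hn => htie i hi n hn p (hlast.trans (hlh.trans hp)))
    (fun i hi => ⟨(hcount i).2.trans (hN i hi).1, (hN i hi).2.1⟩) ?_
  have hNsum : ((∑ i ∈ Finset.Icc 2 k, N i : ℕ) : ℝ) = ∑ i ∈ Finset.Icc 2 k,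
      (crossingTime (postSeeding nsd obs i) b (exploreSize n₀ G 1)).toReal := by
    rw [Nat.cast_sum]
    exact Finset.sum_congr rfl fun i hi => by rw [(hN i hi).2.2, ENNReal.toReal_natCast]
  have : (p : ℝ) ≤ j := by exact_mod_cast hpj
  linarith

variable {m : ℕ → ℝ} {v : ℕ → ℝ≥0} {y σ ε : ℝ} {j : ℕ}

/-- A lower bound for the probability of correct selection with finitely many alternatives. -/
lemma measure_staysAbove_le_pcs (hargmax : IsArgmaxRule argmax) (hk : 1 ≤ k) (hG : 1 ≤ G)
    (hn₀ : G ≤ n₀) (hσ : 0 < σ) (hv : ∀ i ∈ Finset.Icc 2 k, (v i : ℝ) ≤ σ ^ 2) (hy : 0 < y)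
    (hb : ∀ i ∈ Finset.Icc 2 k, m i + σ * y ≤ b) (hm : ∀ i ∈ Finset.Icc 2 k, m i ≠ m 1)
    (hε : 0 < ε)
    (hB : k * ((meanCrossingTime y (exploreSize n₀ G 1)).toReal + ε) + j ≤ (n₀ + ng) * k) :
    iidNormal (m 1) (v 1) (staysAbove b (exploreSize n₀ G G) (exploreSize n₀ G 1) j)
      ≤ pcs argmax rank k G nsd n₀ ng m v
        + ENNReal.ofReal ((∫⁻ z, crossingTime z y (exploreSize n₀ G 1) ^ 2 ∂iidNormal 0 1).toReal
          / ε ^ 2 * (k : ℝ)⁻¹) := by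
  have hh : 1 ≤ exploreSize n₀ G 1 :=
    (one_le_exploreSize_last hG hn₀).trans (exploreSize_antitone hG hG)
  have hlaw := hasLaw_shift_streams m v nsd
  have hmeas := measurableSet_staysAbove b (exploreSize n₀ G G) (exploreSize n₀ G 1) j
  set P := Measure.infinitePi fun p : ℕ × ℕ => gaussianReal (m p.1) (v p.1) with hP
  have hlaw1 := (hasLaw_eval_streamLaw m v 1).comp hlaw
  rw [← hlaw1.map_eq, Measure.map_apply_of_aemeasurable hlaw1.aemeasurable hmeas]
  refine le_trans ?_ (add_le_add le_rfl
    (measure_sum_crossingTime_ge_le (m := m) hk hσ hv hy hb hh hε))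
  -- The tie-breaking rules need not be measurable, so `pcs` may be an outer measure; from here on
  -- only monotonicity and subadditivity are used.
  refine le_trans ?_ (add_le_add le_rfl ((Measure.le_map_apply hlaw.aemeasurable _).trans
    (le_of_eq (by rw [hlaw.map_eq]))))
  refine le_trans (measure_mono_ae ?_) (measure_union_le _ _)
  have htie : ∀ᵐ X ∂streamLaw m v, ∀ i ∈ Finset.Icc 2 k, ∀ n, 1 ≤ n → ∀ p, 1 ≤ p →
      runAvg (X i) n ≠ runAvg (X 1) p := by
    simp only [ae_all_iff, eventually_imp_distrib_left]
    intro i hi n hn p hp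
    exact runAvg_ne_runAvg_ae (by have := (Finset.mem_Icc.1 hi).1; omega) (hm i hi) hn hp
  have hfin : ∀ᵐ X ∂streamLaw m v, ∀ i ∈ Finset.Icc 2 k,
      crossingTime (X i) b (exploreSize n₀ G 1) < ∞ := by
    simp only [ae_all_iff, eventually_imp_distrib_left]
    exact fun i hi => crossingTime_streamLaw_lt_top hσ (hv i hi) hy (hb i hi) hh
  rw [← hlaw.map_eq] at htie hfin
  filter_upwards [ae_of_ae_map hlaw.aemeasurable htie, ae_of_ae_map hlaw.aemeasurable hfin]
    with obs h2 h3 h1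
  rcases lt_or_ge (∑ i ∈ Finset.Icc 2 k,
      (crossingTime (postSeeding nsd obs i) b (exploreSize n₀ G 1)).toReal)
    (k * ((meanCrossingTime y (exploreSize n₀ G 1)).toReal + ε)) with h | h
  · exact Or.inl (efgPlus_eq_one hargmax hk hG hn₀ h1 h2 h3 h hB)
  · exact Or.inr h

/-- The averages converge to `μ₁ > b`, so on the left event only finitely many of them are close to
`b`, and they stay above `b` by a uniform margin. One index `j` controls both that margin and the
time of the future minimum. -/
lemma measure_forall_lt_runAvg_le_iSup {μ₁ b : ℝ} (hb : b < μ₁) (v₁ : ℝ≥0) (lo : ℕ) {hi : ℕ}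
    (hhi : 1 ≤ hi) :
    iidNormal μ₁ v₁ {x | ∀ n, lo ≤ n → b < runAvg x n}
      ≤ ⨆ j : ℕ, iidNormal μ₁ v₁ (staysAbove (b + 1 / ((j : ℝ) + 1)) lo hi j) := by
  have hmono : Monotone fun j : ℕ => staysAbove (b + 1 / ((j : ℝ) + 1)) lo hi j := by
    rintro j l hjl x ⟨h1, p, hpj, hp⟩
    refine ⟨fun n hn => ?_, p, hpj.trans hjl, hp⟩
    have := one_div_le_one_div_of_le (by positivity : (0 : ℝ) < j + 1)
      (by exact_mod_cast Nat.succ_le_succ hjl : (j : ℝ) + 1 ≤ l + 1)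
    linarith [h1 n hn]
  rw [← hmono.measure_iUnion]
  refine measure_mono_ae ?_
  filter_upwards [tendsto_runAvg_iidNormal μ₁ v₁, exists_min_runAvg_iidNormal μ₁ v₁ hhi]
    with x hlim ⟨p, hp, hmin⟩ hx
  obtain ⟨c, hbc, hc⟩ := exists_between hb
  obtain ⟨M, hM⟩ := eventually_atTop.1 (hlim.eventually (lt_mem_nhds hc))
  have hlevel : Tendsto (fun j : ℕ => b + 1 / ((j : ℝ) + 1)) atTop (nhds b) := by
    simpa using (tendsto_one_div_add_atTop_nhds_zero_nat (𝕜 := ℝ)).const_add b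
  have hfin : ∀ᶠ j : ℕ in atTop, ∀ n ∈ Finset.Icc lo M, b + 1 / ((j : ℝ) + 1) < runAvg x n := by
    rw [Filter.eventually_all_finset]
    exact fun n hn => hlevel.eventually (gt_mem_nhds (hx n (Finset.mem_Icc.1 hn).1))
  obtain ⟨j, hj, hjc, hpj⟩ :=
    (hfin.and ((hlevel.eventually (gt_mem_nhds hbc)).and (eventually_ge_atTop p))).exists
  refine Set.mem_iUnion.2 ⟨j, fun n hn => ?_, p, hpj, hp, fun n hn => hmin n (hp.trans hn)⟩
  rcases le_total n M with h | h
  · exact hj n (Finset.mem_Icc.2 ⟨hn, h⟩)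
  · exact hjc.trans (hM n h)

end Selection

end RankSel

/-! ### The main theorem. -/

theorem theorem5
    -- the configuration of the problem with `k` alternatives: means `μ k i`, variances `v k i`
    (μ : ℕ → ℕ → ℝ) (v : ℕ → ℕ → ℝ≥0)
    -- mean and variance of the best alternative, which do not change with `k`
    (μ₁ : ℝ) (v₁ : ℝ≥0)
    (hμ₁ : ∀ k, 1 ≤ k → μ k 1 = μ₁) (hv₁ : ∀ k, 1 ≤ k → v k 1 = v₁)
    -- the asymptotic regime
    (γ σ : ℝ) (hγ : 0 < γ) (hσ : 0 < σ)
    (hgap : ∀ k, ∀ i ∈ Finset.Icc 2 k, γ ≤ μ k 1 - μ k i)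
    (hvar : ∀ k, ∀ i ∈ Finset.Icc 1 k, (v k i : ℝ) ≤ σ ^ 2)
    -- arbitrary tie-breaking
    (argmax : ℕ → (ℕ → ℝ) → ℕ) (hargmax : RankSel.IsArgmaxRule argmax)
    (rank : ℕ → (ℕ → ℝ) → ℕ → ℕ) (hrank : RankSel.IsRankingRule rank)
    -- the parameters of the procedure
    (G nsd n₀ : ℕ) (ng : ℝ) (hG : 2 ≤ G) (hn₀ : G ≤ n₀) (hnsd : 1 ≤ nsd)
    (hng : RankSel.meanCrossingTime (γ / σ) (RankSel.exploreSize n₀ G 1)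
      < ENNReal.ofReal (n₀ + ng)) :
    (∃ γ₀ : ℝ, 0 < γ₀ ∧ γ₀ < γ ∧
      RankSel.meanCrossingTime ((γ - γ₀) / σ) (RankSel.exploreSize n₀ G 1)
        = ENNReal.ofReal (n₀ + ng)) ∧
    ∀ γ₀ : ℝ, 0 < γ₀ → γ₀ < γ →
      RankSel.meanCrossingTime ((γ - γ₀) / σ) (RankSel.exploreSize n₀ G 1)
        = ENNReal.ofReal (n₀ + ng) →
      RankSel.iidNormal μ₁ v₁
          {x | ∀ n : ℕ, RankSel.exploreSize n₀ G G ≤ n → μ₁ - γ₀ < RankSel.runAvg x n}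
        ≤ liminf (fun k : ℕ => RankSel.pcs argmax rank k G nsd n₀ ng (μ k) (v k)) atTop := by
  have hG1 : 1 ≤ G := by omega
  have hh : 1 ≤ RankSel.exploreSize n₀ G 1 :=
    (RankSel.one_le_exploreSize_last hG1 hn₀).trans (RankSel.exploreSize_antitone hG1 hG1)
  refine ⟨RankSel.exists_meanCrossingTime_eq hh hγ hσ ENNReal.ofReal_ne_top hng, ?_⟩
  intro γ₀ hγ₀ hγ₀γ hC
  refine (RankSel.measure_forall_lt_runAvg_le_iSup (b := μ₁ - γ₀) (by linarith) v₁ _ hh).trans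
    (iSup_le fun j => ?_)
  set δ : ℝ := 1 / ((j : ℝ) + 1) with hδ
  have hδ0 : 0 < δ := by positivity
  -- Chosen so that `σ * y = γ - γ₀ + δ`: a rival's mean plus `σ * y` is then at most the raised
  -- level `μ₁ - γ₀ + δ`.
  set y : ℝ := (γ - γ₀) / σ + δ / σ with hy
  have hx0 : 0 < (γ - γ₀) / σ := div_pos (by linarith) hσ
  have hxy : (γ - γ₀) / σ < y := by
    rw [hy]; linarith [div_pos hδ0 hσ]
  have hy0 : 0 < y := hx0.trans hxy
  have hlt := RankSel.meanCrossingTime_strictAnti hx0 hxy hh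
  rw [hC, ENNReal.lt_ofReal_iff_toReal_lt (RankSel.meanCrossingTime_lt_top hy0 _).ne] at hlt
  set C := (RankSel.meanCrossingTime y (RankSel.exploreSize n₀ G 1)).toReal with hCdef
  -- Half of the slack per alternative absorbs the Chebyshev deviation; the other half, `k * ε`,
  -- covers the bound `j` on the time of the future minimum once `k ≥ j / ε`.
  set ε : ℝ := (n₀ + ng - C) / 2 with hε
  have hε0 : 0 < ε := by rw [hε]; linarith
  set D := (∫⁻ z, RankSel.crossingTime z y (RankSel.exploreSize n₀ G 1) ^ 2
    ∂(RankSel.iidNormal 0 1)).toReal with hD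
  set A := RankSel.iidNormal μ₁ v₁ (RankSel.staysAbove (μ₁ - γ₀ + δ)
    (RankSel.exploreSize n₀ G G) (RankSel.exploreSize n₀ G 1) j) with hA
  have hlim : Tendsto (fun k : ℕ => A - ENNReal.ofReal (D / ε ^ 2 * (k : ℝ)⁻¹)) atTop
      (nhds A) := by
    have h1 : Tendsto (fun k : ℕ => D / ε ^ 2 * (k : ℝ)⁻¹) atTop (nhds 0) := by
      simpa using (tendsto_inv_atTop_nhds_zero_nat (𝕜 := ℝ)).const_mul (D / ε ^ 2)
    have h2 := ENNReal.tendsto_ofReal h1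
    rw [ENNReal.ofReal_zero] at h2
    simpa using ENNReal.Tendsto.sub (tendsto_const_nhds (x := A)) h2 (Or.inr ENNReal.zero_ne_top)
  rw [← hlim.liminf_eq]
  refine liminf_le_liminf ?_
  filter_upwards [eventually_ge_atTop 1, eventually_ge_atTop ⌈(j : ℝ) / ε⌉₊] with k hk hkj
  have hkj' : (j : ℝ) ≤ k * ε := (div_le_iff₀ hε0).1 (Nat.ceil_le.1 hkj)
  have hgap' : ∀ i ∈ Finset.Icc 2 k, γ ≤ μ₁ - μ k i := fun i hi => by
    rw [← hμ₁ k hk]; exact hgap k i hi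
  rw [tsub_le_iff_right]
  have := RankSel.measure_staysAbove_le_pcs (rank := rank) (nsd := nsd) (ng := ng) (m := μ k)
    (v := v k) (b := μ₁ - γ₀ + δ) (j := j) hargmax hk hG1 hn₀ hσ
    (fun i hi => hvar k i (Finset.Icc_subset_Icc_left (by norm_num) hi)) hy0
    (fun i hi => by
      have h1 := hgap' i hi
      have h2 : σ * y = γ - γ₀ + δ := by rw [hy]; field_simp
      linarith)
    (fun i hi => by
      have h1 := hgap k i hi
      intro h
      linarith) hε0 (by
      have : (n₀ + ng) = C + 2 * ε := by rw [hε]; ring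
      rw [this]
      nlinarith)
  rwa [hμ₁ k hk, hv₁ k hk] at this
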